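/- Let $\mathcal{M}$ be a cocomplete abelian monoidal category (that is, $\mathcal{M}$ is a cocomplete abelian category with a monoidal structure $(\otimes,\mathbf 1)$ such that all functors $X\otimes(-)$ and $(-)\otimes X$ are additive and right exact), and assume that the tensor product commutes with direct sums. Let $A$ be an algebra in $\mathcal{M}$ and let $I$ be an ideal of $A$, i.e. an $A$-bimodule with a morphism of $A$-bimodules $I\to A$ that is a monomorphism in $\mathcal{M}$. For subobjects $J,K$ of an algebra $R$ in $\mathcal{M}$, let $JK$ be the image of $J\otimes K\to R\otimes R\to R$, and let $J^0=R$, $J^1=J$, $J^{n+1}=J^nJ$. Let $gr_IA=\bigoplus_{n\in\mathbb N}gr_I^nA$, $gr^n_IA=I^n/I^{n+1}$, be the associated graded algebra, with the multiplication $m_{a,b}:gr_I^aA\otimes gr_I^bA\to gr_I^{a+b}A$ induced by $I^a\otimes I^b\to I^{a+b}$. Let $i_n$ and $p_n$ denote the canonical injections and projections of $gr_IA$, and let $T=T_{A/I}(I/I^2)=\bigoplus_{n\in\mathbb N}(I/I^2)^{\otimes_{A/I}n}$ be the tensor algebra of the $A/I$-bimodule $I/I^2$, with canonical injections $i_n^T$.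 Then there is a unique algebra homomorphism $\varphi:T_{A/I}(I/I^2)\to gr_IA$ such that $\varphi\circ i_0^T=i_0$ and $\varphi\circ i_1^T=i_1$. Moreover $\varphi$ is a graded algebra homomorphism, $\varphi=\bigoplus_{t}\varphi_t$, with $$\varphi_t=p_t\circ\overline m^{\,t-1}\circ (i_1)^{\otimes_{A/I}t}\qquad\text{for every }t\in\mathbb N,$$ where $\overline m^{\,t-1}:(gr_IA)^{\otimes_{A/I}t}\to gr_IA$ is the iterated multiplication over $A/I$ (for $t=0$ it is $i_0:A/I\to gr_IA$, for $t=1$ the identity). Furthermore, the following assertions are equivalent, and they all hold: (a) $gr_IA$ is strongly $\mathbb N$-graded, i.e. $m_{i,j}$ is an epimorphism for all $i,j\in\mathbb N$; (a$'$) $m_{a,1}:gr_I^aA\otimes gr_I^1A\to gr_I^{a+1}A$ is an epimorphism for every $a\in\mathbb N$; (b) $\varphi_n$ is an epimorphism for every $n\in\mathbb N$; (c) $\varphi$ is an epimorphism in $\mathcal{M}$; (d) $\bigoplus_{i\ge n}gr_I^iA=\big(\bigoplus_{i\ge1}gr_I^iA\big)^n$ as subobjects of $gr_IA$, for every $n\in\mathbb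 N$; (e) $\bigoplus_{i\ge2}gr_I^iA=\big(\bigoplus_{i\ge1}gr_I^iA\big)^2$ as subobjects of $gr_IA$. -/

import Mathlib

open CategoryTheory MonoidalCategory Limits

universe v u v' u'

set_option linter.unusedSectionVars false

namespace AssocGraded

/-! ### Graded algebras -/

/-- A graded algebra in a monoidal category, given by its homogeneous components `X n`, its local
multiplications `X a ⊗ X b ⟶ X c` for `a + b = c`, and its unit. -/
structure GradedAlg (D : Type u) [Category.{v} D] [MonoidalCategory D] where
  X : ℕ → D
  mul : ∀ {a b c : ℕ}, a + b = c → (X a ⊗ X b ⟶ X c)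
  one : 𝟙_ D ⟶ X 0
  one_mul : ∀ a : ℕ, one ▷ X a ≫ mul (Nat.zero_add a) = (λ_ (X a)).hom
  mul_one : ∀ a : ℕ, X a ◁ one ≫ mul (Nat.add_zero a) = (ρ_ (X a)).hom
  assoc : ∀ {a b c ab bc abc : ℕ} (h₁ : a + b = ab) (h₂ : ab + c = abc) (h₃ : b + c = bc)
    (h₄ : a + bc = abc),
    mul h₁ ▷ X c ≫ mul h₂ = (α_ (X a) (X b) (X c)).hom ≫ X a ◁ mul h₃ ≫ mul h₄

section Powers

variable {D : Type u} [Category.{v} D] [MonoidalCategory D]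

/-- Tensor powers `M^{⊗ 0} = 𝟙`, `M^{⊗ (n+1)} = M^{⊗ n} ⊗ M`. -/
def tpow (M : D) : ℕ → D
  | 0 => 𝟙_ D
  | n + 1 => tpow M n ⊗ M

/-- The tensor power of a morphism. -/
def tpowMap {M N : D} (f : M ⟶ N) : ∀ n : ℕ, tpow M n ⟶ tpow N n
  | 0 => 𝟙 (𝟙_ D)
  | n + 1 => tpowMap f n ⊗ₘ f

/-- The iterated multiplication `R^{⊗ n} ⟶ R` of an object `R` with multiplication `m` and
unit `e`: it is `e` for `n = 0`, and for `n + 1` it is the one for `n` followed by `m`. -/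
def iterMul {R : D} (m : R ⊗ R ⟶ R) (e : 𝟙_ D ⟶ R) : ∀ n : ℕ, tpow R n ⟶ R
  | 0 => e
  | n + 1 => iterMul m e n ▷ R ≫ m

/-- Concatenation `M^{⊗ a} ⊗ M^{⊗ b} ⟶ M^{⊗ (a+b)}` (the canonical isomorphism). -/
def tpowMulAux (M : D) (a : ℕ) : ∀ b : ℕ, tpow M a ⊗ tpow M b ⟶ tpow M (a + b)
  | 0 => (ρ_ (tpow M a)).hom
  | b + 1 => (α_ (tpow M a) (tpow M b) M).inv ≫ tpowMulAux M a b ▷ M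

/-- Concatenation `M^{⊗ a} ⊗ M^{⊗ b} ⟶ M^{⊗ c}`, for `a + b = c`. -/
def tpowMul (M : D) {a b c : ℕ} (h : a + b = c) : tpow M a ⊗ tpow M b ⟶ tpow M c :=
  tpowMulAux M a b ≫ eqToHom (congrArg (tpow M) h)

theorem tpowMul_zero (M : D) (a : ℕ) : tpowMul M (Nat.add_zero a) = (ρ_ (tpow M a)).hom := by
  exact Category.comp_id _

theorem tpowMul_succ (M : D) {a b c : ℕ} (h : a + b = c) :
    tpowMul M (show a + (b + 1) = c + 1 by omega) =
      (α_ (tpow M a) (tpow M b) M).inv ≫ tpowMul M h ▷ M := by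
  subst h
  have e : ∀ k, tpowMul M (rfl : a + k = a + k) = tpowMulAux M a k := fun _ => Category.comp_id _
  refine (e (b + 1)).trans ?_
  rw [e]
  rfl

theorem tpow_one_mul (M : D) (a : ℕ) :
    tpowMul M (Nat.zero_add a) = (λ_ (tpow M a)).hom := by
  induction a with
  | zero => rw [tpowMul_zero]; exact unitors_equal.symm
  | succ a ih =>
    rw [tpowMul_succ M (Nat.zero_add a), ih]
    simp [tpow]

theorem tpow_assoc (M : D) {a b c ab bc abc : ℕ} (h₁ : a + b = ab) (h₂ : ab + c = abc)
    (h₃ : b + c = bc) (h₄ : a + bc = abc) :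
    tpowMul M h₁ ▷ tpow M c ≫ tpowMul M h₂ =
      (α_ (tpow M a) (tpow M b) (tpow M c)).hom ≫ tpow M a ◁ tpowMul M h₃ ≫ tpowMul M h₄ := by
  induction c generalizing bc abc with
  | zero =>
    obtain rfl : bc = b := by omega
    obtain rfl : abc = ab := by omega
    rw [tpowMul_zero, tpowMul_zero]
    change _ ▷ 𝟙_ D ≫ _ = _
    rw [rightUnitor_naturality]
    simp [tpow]
  | succ c ih =>
    obtain ⟨bc, rfl⟩ : ∃ k, bc = k + 1 := ⟨b + c, by omega⟩
    obtain ⟨abc, rfl⟩ : ∃ k, abc = k + 1 := ⟨a + bc, by omega⟩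
    have h₂' : ab + c = abc := by omega
    have h₃' : b + c = bc := by omega
    have h₄' : a + bc = abc := by omega
    rw [tpowMul_succ M h₂', tpowMul_succ M h₃', tpowMul_succ M h₄']
    have := congrArg (· ▷ M) (ih h₂' h₃' h₄')
    simp only [comp_whiskerRight] at this
    simp only [tpow, whiskerLeft_comp, Category.assoc]
    rw [associator_inv_naturality_left_assoc, this]
    simp

/-- The tensor powers of an object, as a graded algebra. -/
def tpowGraded (M : D) : GradedAlg D where
  X := tpow M
  mul h := tpowMul M h
  one := 𝟙 (𝟙_ D)
  one_mul a := by
    rw [tpow_one_mul]; exact (congrArg (· ≫ _) (id_whiskerRight _ _)).trans (Category.id_comp _)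
  mul_one a := by
    rw [tpowMul_zero]; exact (congrArg (· ≫ _) (whiskerLeft_id _ _)).trans (Category.id_comp _)
  assoc h₁ h₂ h₃ h₄ := tpow_assoc M h₁ h₂ h₃ h₄

end Powers

/-- The image of a graded algebra under a lax monoidal functor. -/
def GradedAlg.map {D : Type u'} [Category.{v'} D] [MonoidalCategory D] {C : Type u} [Category.{v} C]
    [MonoidalCategory C] (G : GradedAlg D) (F : D ⥤ C) [F.LaxMonoidal] : GradedAlg C where
  X n := F.obj (G.X n)
  mul h := Functor.LaxMonoidal.μ F _ _ ≫ F.map (G.mul h)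
  one := Functor.LaxMonoidal.ε F ≫ F.map G.one
  one_mul a := by
    rw [comp_whiskerRight, Category.assoc, Functor.LaxMonoidal.μ_natural_left_assoc,
      ← F.map_comp, G.one_mul, ← Functor.LaxMonoidal.left_unitality]
  mul_one a := by
    rw [whiskerLeft_comp, Category.assoc, Functor.LaxMonoidal.μ_natural_right_assoc,
      ← F.map_comp, G.mul_one, ← Functor.LaxMonoidal.right_unitality]
  assoc h₁ h₂ h₃ h₄ := by
    rw [comp_whiskerRight, Category.assoc, Functor.LaxMonoidal.μ_natural_left_assoc,
      ← F.map_comp, G.assoc h₁ h₂ h₃ h₄, whiskerLeft_comp, Category.assoc,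
      Functor.LaxMonoidal.μ_natural_right_assoc]
    simp

/-! ### The total algebra of a graded algebra -/

section Total

variable {C : Type u} [Category.{v} C] [MonoidalCategory C] [HasColimitsOfSize.{0, 0} C]
  [∀ X : C, PreservesColimitsOfSize.{0, 0} (tensorLeft X)]
  [∀ X : C, PreservesColimitsOfSize.{0, 0} (tensorRight X)]

/-- The morphism `(⊕ X i) ⊗ W ⟶ Z` with given components `X i ⊗ W ⟶ Z`. -/
noncomputable def sigmaTensorDesc {X : ℕ → C} {W Z : C} (f : ∀ i, X i ⊗ W ⟶ Z) :
    (∐ X) ⊗ W ⟶ Z :=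
  (PreservesCoproduct.iso (tensorRight W) X).hom ≫ Sigma.desc f

/-- The morphism `W ⊗ (⊕ X i) ⟶ Z` with given components `W ⊗ X i ⟶ Z`. -/
noncomputable def tensorSigmaDesc {X : ℕ → C} {W Z : C} (f : ∀ i, W ⊗ X i ⟶ Z) :
    W ⊗ (∐ X) ⟶ Z :=
  (PreservesCoproduct.iso (tensorLeft W) X).hom ≫ Sigma.desc f

theorem ι_sigmaTensorDesc {X : ℕ → C} {W Z : C} (f : ∀ i, X i ⊗ W ⟶ Z) (i : ℕ) :
    Sigma.ι X i ▷ W ≫ sigmaTensorDesc f = f i := by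
  have h : Sigma.ι X i ▷ W ≫ (PreservesCoproduct.iso (tensorRight W) X).hom =
      Sigma.ι (fun j => X j ⊗ W) i := by
    rw [← Iso.eq_comp_inv]
    exact (ι_comp_sigmaComparison (tensorRight W) X i).symm
  rw [sigmaTensorDesc, reassoc_of% h]
  exact Sigma.ι_desc _ _

theorem ι_tensorSigmaDesc {X : ℕ → C} {W Z : C} (f : ∀ i, W ⊗ X i ⟶ Z) (i : ℕ) :
    W ◁ Sigma.ι X i ≫ tensorSigmaDesc f = f i := by
  have h : W ◁ Sigma.ι X i ≫ (PreservesCoproduct.iso (tensorLeft W) X).hom =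
      Sigma.ι (fun j => W ⊗ X j) i := by
    rw [← Iso.eq_comp_inv]
    exact (ι_comp_sigmaComparison (tensorLeft W) X i).symm
  rw [tensorSigmaDesc, reassoc_of% h]
  exact Sigma.ι_desc _ _

theorem sigmaTensor_hom_ext {X : ℕ → C} {W Z : C} {f g : (∐ X) ⊗ W ⟶ Z}
    (h : ∀ i, Sigma.ι X i ▷ W ≫ f = Sigma.ι X i ▷ W ≫ g) : f = g := by
  rw [← cancel_epi (PreservesCoproduct.iso (tensorRight W) X).inv]
  refine Sigma.hom_ext _ _ fun i => ?_
  have e : Sigma.ι (fun j => (tensorRight W).obj (X j)) i ≫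
      (PreservesCoproduct.iso (tensorRight W) X).inv = Sigma.ι X i ▷ W :=
    ι_comp_sigmaComparison (tensorRight W) X i
  rw [reassoc_of% e, reassoc_of% e]
  exact h i

theorem tensorSigma_hom_ext {X : ℕ → C} {W Z : C} {f g : W ⊗ (∐ X) ⟶ Z}
    (h : ∀ i, W ◁ Sigma.ι X i ≫ f = W ◁ Sigma.ι X i ≫ g) : f = g := by
  rw [← cancel_epi (PreservesCoproduct.iso (tensorLeft W) X).inv]
  refine Sigma.hom_ext _ _ fun i => ?_
  have e : Sigma.ι (fun j => (tensorLeft W).obj (X j)) i ≫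
      (PreservesCoproduct.iso (tensorLeft W) X).inv = W ◁ Sigma.ι X i :=
    ι_comp_sigmaComparison (tensorLeft W) X i
  rw [reassoc_of% e, reassoc_of% e]
  exact h i

theorem sigmaTensor_hom_ext₃ {X : ℕ → C} {Z : C} {f g : ((∐ X) ⊗ (∐ X)) ⊗ (∐ X) ⟶ Z}
    (h : ∀ a b c, ((Sigma.ι X a ⊗ₘ Sigma.ι X b) ⊗ₘ Sigma.ι X c) ≫ f =
      ((Sigma.ι X a ⊗ₘ Sigma.ι X b) ⊗ₘ Sigma.ι X c) ≫ g) : f = g := by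
  refine tensorSigma_hom_ext fun c => ?_
  rw [← cancel_epi (α_ (∐ X) (∐ X) (X c)).inv]
  refine sigmaTensor_hom_ext fun a => ?_
  rw [associator_inv_naturality_left_assoc, associator_inv_naturality_left_assoc,
    ← cancel_epi (α_ (X a) (∐ X) (X c)).hom, Iso.hom_inv_id_assoc, Iso.hom_inv_id_assoc,
    ← cancel_epi (α_ (X a) (∐ X) (X c)).inv,
    ← cancel_epi (α_ (X a) (∐ X) (X c)).hom, Iso.hom_inv_id_assoc, Iso.hom_inv_id_assoc]
  suffices H : ∀ {W : C} {f g : (X a ⊗ (∐ X)) ⊗ X c ⟶ W},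
      (∀ b, (X a ◁ Sigma.ι X b) ▷ X c ≫ f = (X a ◁ Sigma.ι X b) ▷ X c ≫ g) → f = g by
    refine H fun b => ?_
    have := h a b c
    rw [MonoidalCategory.tensorHom_def (_ ⊗ₘ _)] at this
    simpa only [MonoidalCategory.tensorHom_def', comp_whiskerRight, Category.assoc] using this
  intro W f g h
  rw [← cancel_epi (α_ (X a) (∐ X) (X c)).inv]
  rw [← cancel_epi ((tensorLeft (X a)).map (PreservesCoproduct.iso (tensorRight (X c)) X).inv)]
  refine (cancel_epi (PreservesCoproduct.iso (tensorLeft (X a)) _).inv).1 ?_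
  refine Sigma.hom_ext _ _ fun b => ?_
  have e₁ : Sigma.ι (fun j => (tensorRight (X c)).obj (X j)) b ≫
      (PreservesCoproduct.iso (tensorRight (X c)) X).inv = Sigma.ι X b ▷ X c :=
    ι_comp_sigmaComparison (tensorRight (X c)) X b
  have e₂ : Sigma.ι (fun j => (tensorLeft (X a)).obj ((tensorRight (X c)).obj (X j))) b ≫
      (PreservesCoproduct.iso (tensorLeft (X a)) _).inv =
      X a ◁ Sigma.ι (fun j => (tensorRight (X c)).obj (X j)) b :=
    ι_comp_sigmaComparison (tensorLeft (X a)) (fun j => (tensorRight (X c)).obj (X j)) b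
  have e₃ : X a ◁ Sigma.ι (fun j => (tensorRight (X c)).obj (X j)) b ≫
      (tensorLeft (X a)).map (PreservesCoproduct.iso (tensorRight (X c)) X).inv =
      X a ◁ Sigma.ι X b ▷ X c :=
    (whiskerLeft_comp _ _ _).symm.trans (congrArg _ e₁)
  rw [reassoc_of% e₂, reassoc_of% e₂, reassoc_of% e₃, reassoc_of% e₃,
    associator_inv_naturality_middle_assoc, associator_inv_naturality_middle_assoc, h b]

variable (G : GradedAlg C)

/-- The multiplication of `⊕ₙ Xₙ`, with components the local multiplications. -/
noncomputable def GradedAlg.totalMul : (∐ G.X) ⊗ (∐ G.X) ⟶ ∐ G.X :=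
  sigmaTensorDesc fun a => tensorSigmaDesc fun b => G.mul (rfl : a + b = a + b) ≫ Sigma.ι G.X (a + b)

theorem GradedAlg.ι_mul_ι {a b c : ℕ} (h : a + b = c) :
    (Sigma.ι G.X a ⊗ₘ Sigma.ι G.X b) ≫ G.totalMul = G.mul h ≫ Sigma.ι G.X c := by
  subst h
  rw [tensorHom_def', Category.assoc, totalMul, ι_sigmaTensorDesc, ι_tensorSigmaDesc]

theorem GradedAlg.total_one_mul :
    (G.one ≫ Sigma.ι G.X 0) ▷ (∐ G.X) ≫ G.totalMul = (λ_ (∐ G.X)).hom := by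
  refine tensorSigma_hom_ext fun a => ?_
  have h := G.ι_mul_ι (Nat.zero_add a)
  rw [tensorHom_def'] at h
  rw [whisker_exchange_assoc, comp_whiskerRight, Category.assoc, ← whisker_exchange_assoc,
    ← Category.assoc (_ ◁ _), h, ← Category.assoc, G.one_mul, leftUnitor_naturality]

theorem GradedAlg.total_mul_one :
    (∐ G.X) ◁ (G.one ≫ Sigma.ι G.X 0) ≫ G.totalMul = (ρ_ (∐ G.X)).hom := by
  refine sigmaTensor_hom_ext fun a => ?_
  have h := G.ι_mul_ι (Nat.add_zero a)
  rw [tensorHom_def', Category.assoc] at h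
  rw [← whisker_exchange_assoc, whiskerLeft_comp, Category.assoc,
    h, ← Category.assoc, G.mul_one, rightUnitor_naturality]

theorem GradedAlg.total_assoc :
    G.totalMul ▷ (∐ G.X) ≫ G.totalMul =
      (α_ (∐ G.X) (∐ G.X) (∐ G.X)).hom ≫ (∐ G.X) ◁ G.totalMul ≫ G.totalMul := by
  refine sigmaTensor_hom_ext₃ fun a b c => ?_
  have key : ∀ {a b c : ℕ} (h : a + b = c), (Sigma.ι G.X a ⊗ₘ Sigma.ι G.X b) ≫ G.totalMul =
    G.mul h ≫ Sigma.ι G.X c := fun h => G.ι_mul_ι h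
  rw [← tensorHom_id, tensorHom_comp_tensorHom_assoc, key rfl, Category.comp_id,
    ← Category.id_comp (Sigma.ι G.X c), ← tensorHom_comp_tensorHom_assoc, key rfl, tensorHom_id,
    ← Category.assoc, G.assoc rfl rfl rfl (add_assoc a b c).symm, Category.id_comp,
    associator_naturality_assoc, ← id_tensorHom (∐ G.X), tensorHom_comp_tensorHom_assoc, key rfl,
    Category.comp_id, ← Category.id_comp (Sigma.ι G.X a), ← tensorHom_comp_tensorHom_assoc,
    key (add_assoc a b c).symm, id_tensorHom]
  simp only [Category.assoc]

/-- The algebra `⊕ₙ Xₙ` of a graded algebra. -/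
noncomputable def GradedAlg.total : Mon C where
  X := ∐ G.X
  mon :=
    { one := G.one ≫ Sigma.ι G.X 0
      mul := G.totalMul
      one_mul := G.total_one_mul
      mul_one := G.total_mul_one
      mul_assoc := G.total_assoc }

end Total

/-! ### Bimodules over an algebra -/

section Bimodules

variable {C : Type u} [Category.{v} C] [MonoidalCategory C] [HasCoequalizers C]
  [∀ X : C, PreservesColimitsOfSize.{0, 0} (tensorLeft X)]
  [∀ X : C, PreservesColimitsOfSize.{0, 0} (tensorRight X)]

/-- The monoidal category of `B`-bimodules, with tensor product `⊗_B` and unit `B`. -/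
noncomputable instance bimodMonoidal (B : Mon C) : MonoidalCategory (Bimod B B) where
  tensorObj M N := Bimod.tensorBimod M N
  whiskerLeft M _ _ f := Bimod.whiskerLeft M f
  whiskerRight f N := Bimod.whiskerRight f N
  tensorUnit := Bimod.regular B
  associator := Bimod.associatorBimod
  leftUnitor := Bimod.leftUnitorBimod
  rightUnitor := Bimod.rightUnitorBimod
  id_tensorHom_id _ _ := by
    dsimp only
    rw [Bimod.id_whiskerRight_bimod, Bimod.whiskerLeft_id_bimod, Category.comp_id]
  tensorHom_comp_tensorHom f g h k := by
    dsimp only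
    rw [Bimod.whiskerLeft_comp_bimod, Bimod.comp_whiskerRight_bimod, Category.assoc,
      Category.assoc, ← Category.assoc (Bimod.whiskerLeft _ _) (Bimod.whiskerRight _ _),
      Bimod.whisker_exchange_bimod, Category.assoc]
  whiskerLeft_id _ _ := Bimod.whiskerLeft_id_bimod
  id_whiskerRight _ _ := Bimod.id_whiskerRight_bimod
  associator_naturality {M₁ M₂ M₃ N₁ N₂ N₃} f g h := by
    dsimp only
    simp only [Bimod.comp_whiskerRight_bimod, Bimod.whiskerLeft_comp_bimod,
      Bimod.comp_whiskerLeft_bimod, Bimod.whisker_assoc_bimod, Bimod.whiskerRight_comp_bimod,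
      Category.assoc, Iso.inv_hom_id, Category.comp_id, Iso.inv_hom_id_assoc,
      Iso.hom_inv_id_assoc]
  leftUnitor_naturality f := by
    rw [Bimod.id_whiskerLeft_bimod]; simp
  rightUnitor_naturality f := by
    rw [Bimod.whiskerRight_id_bimod]; simp
  pentagon M N P Q := Bimod.pentagon_bimod M N P Q
  triangle M N := Bimod.triangle_bimod M N

variable {B : Mon C}

/-- The canonical epimorphism `M ⊗ N ⟶ M ⊗_B N`. -/
noncomputable def bimodπ (M N : Bimod B B) : M.X ⊗ N.X ⟶ (M ⊗ N : Bimod B B).X :=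
  coequalizer.π (M.actRight ▷ N.X) ((α_ M.X B.X N.X).hom ≫ M.X ◁ N.actLeft)

instance (M N : Bimod B B) : Epi (bimodπ M N) :=
  coequalizer.π_epi

theorem bimodπ_condition (M N : Bimod B B) :
    M.actRight ▷ N.X ≫ bimodπ M N = (α_ M.X B.X N.X).hom ≫ M.X ◁ N.actLeft ≫ bimodπ M N :=
  (coequalizer.condition _ _).trans (Category.assoc _ _ _)

theorem bimodπ_whiskerRight {M M' : Bimod B B} (f : M ⟶ M') (N : Bimod B B) :
    bimodπ M N ≫ (f ▷ N).hom = f.hom ▷ N.X ≫ bimodπ M' N :=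
  ι_colimMap _ _

theorem bimodπ_whiskerLeft (M : Bimod B B) {N N' : Bimod B B} (f : N ⟶ N') :
    bimodπ M N ≫ (M ◁ f).hom = M.X ◁ f.hom ≫ bimodπ M N' :=
  ι_colimMap _ _

theorem bimodπ_leftUnitor (M : Bimod B B) :
    bimodπ (𝟙_ (Bimod B B)) M ≫ (λ_ M).hom.hom = M.actLeft :=
  coequalizer.π_desc _ _

theorem bimodπ_rightUnitor (M : Bimod B B) :
    bimodπ M (𝟙_ (Bimod B B)) ≫ (ρ_ M).hom.hom = M.actRight :=
  coequalizer.π_desc _ _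

theorem bimodπ_associator (M N P : Bimod B B) :
    bimodπ M N ▷ P.X ≫ bimodπ (M ⊗ N) P ≫ (α_ M N P).hom.hom =
      (α_ M.X N.X P.X).hom ≫ M.X ◁ bimodπ N P ≫ bimodπ M (N ⊗ P) := by
  have h : bimodπ (M ⊗ N) P ≫ (α_ M N P).hom.hom = Bimod.AssociatorBimod.homAux M N P :=
    coequalizer.π_desc _ _
  rw [h]
  exact π_tensor_id_preserves_coequalizer_inv_desc _ _ _ _

theorem bimodπ_actLeft (M N : Bimod B B) :
    B.X ◁ bimodπ M N ≫ (M ⊗ N : Bimod B B).actLeft =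
      (α_ _ _ _).inv ≫ M.actLeft ▷ N.X ≫ bimodπ M N :=
  Bimod.TensorBimod.whiskerLeft_π_actLeft M N

theorem bimodπ_actRight (M N : Bimod B B) :
    bimodπ M N ▷ B.X ≫ (M ⊗ N : Bimod B B).actRight =
      (α_ _ _ _).hom ≫ M.X ◁ N.actRight ≫ bimodπ M N :=
  Bimod.TensorBimod.π_tensor_id_actRight M N

/-- The forgetful functor from `B`-bimodules is lax monoidal, through `B`'s unit and the
canonical epimorphisms `M ⊗ N ⟶ M ⊗_B N`. -/
noncomputable instance bimodForgetLax : (Bimod.forget B : Bimod B B ⥤ C).LaxMonoidal where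
  ε := MonObj.one (X := B.X)
  μ M N := bimodπ M N
  μ_natural_left f N := (bimodπ_whiskerRight f N).symm
  μ_natural_right M f := (bimodπ_whiskerLeft M f).symm
  associativity M N P := bimodπ_associator M N P
  left_unitality M := by
    refine M.one_actLeft.symm.trans ?_
    exact congrArg (_ ≫ ·) (bimodπ_leftUnitor M).symm
  right_unitality M := by
    refine M.actRight_one.symm.trans ?_
    exact congrArg (_ ≫ ·) (bimodπ_rightUnitor M).symm

/-- The morphism `M ⊗_B N ⟶ Z` induced by a `B`-balanced morphism `M ⊗ N ⟶ Z`. -/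
noncomputable def balancedDesc {M N : Bimod B B} {Z : C} (f : M.X ⊗ N.X ⟶ Z)
    (hm : M.actRight ▷ N.X ≫ f = (α_ M.X B.X N.X).hom ≫ M.X ◁ N.actLeft ≫ f) :
    (M ⊗ N : Bimod B B).X ⟶ Z :=
  coequalizer.desc f (hm.trans (Category.assoc _ _ _).symm)

theorem π_balancedDesc {M N : Bimod B B} {Z : C} (f : M.X ⊗ N.X ⟶ Z)
    (hm : M.actRight ▷ N.X ≫ f = (α_ M.X B.X N.X).hom ≫ M.X ◁ N.actLeft ≫ f) :
    bimodπ M N ≫ balancedDesc f hm = f :=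
  coequalizer.π_desc _ _

/-- The morphism of bimodules `M ⊗_B N ⟶ P` induced by a `B`-balanced morphism of bimodules
`M ⊗ N ⟶ P`. -/
noncomputable def bimodDesc {M N P : Bimod B B} (f : M.X ⊗ N.X ⟶ P.X)
    (hm : M.actRight ▷ N.X ≫ f = (α_ M.X B.X N.X).hom ≫ M.X ◁ N.actLeft ≫ f)
    (hl : M.actLeft ▷ N.X ≫ f = (α_ B.X M.X N.X).hom ≫ B.X ◁ f ≫ P.actLeft)
    (hr : M.X ◁ N.actRight ≫ f = (α_ M.X N.X B.X).inv ≫ f ▷ B.X ≫ P.actRight) :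
    M ⊗ N ⟶ P where
  hom := balancedDesc f hm
  left_act_hom := by
    have : Epi (B.X ◁ bimodπ M N) := inferInstanceAs (Epi ((tensorLeft B.X).map (bimodπ M N)))
    rw [← cancel_epi (B.X ◁ bimodπ M N), ← Category.assoc, bimodπ_actLeft,
      ← whiskerLeft_comp_assoc, π_balancedDesc, Category.assoc, Category.assoc, π_balancedDesc,
      hl, Iso.inv_hom_id_assoc]
  right_act_hom := by
    have : Epi (bimodπ M N ▷ B.X) := inferInstanceAs (Epi ((tensorRight B.X).map (bimodπ M N)))
    rw [← cancel_epi (bimodπ M N ▷ B.X), ← Category.assoc, bimodπ_actRight,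
      ← comp_whiskerRight_assoc, π_balancedDesc, Category.assoc, Category.assoc, π_balancedDesc,
      hr, Iso.hom_inv_id_assoc]

variable {E : Mon C} (f : B ⟶ E)

/-- An algebra `E` as a bimodule over `B`, through an algebra homomorphism `B ⟶ E`. -/
def restrictBimod : Bimod B B where
  X := E.X
  actLeft := f.hom ▷ E.X ≫ MonObj.mul
  actRight := E.X ◁ f.hom ≫ MonObj.mul
  one_actLeft := by
    rw [← comp_whiskerRight_assoc, IsMonHom.one_hom, MonObj.one_mul]
  actRight_one := by
    rw [← whiskerLeft_comp_assoc, IsMonHom.one_hom, MonObj.mul_one]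
  left_assoc := by
    rw [← comp_whiskerRight_assoc, IsMonHom.mul_hom]
    simp only [comp_whiskerRight, MonoidalCategory.tensorHom_def, MonObj.mul_assoc,
      Category.assoc, whiskerLeft_comp]
    rw [whisker_exchange_assoc]
    simp
    rw [← associator_inv_naturality_left_assoc, Iso.inv_hom_id_assoc, whisker_exchange_assoc,
      associator_naturality_left_assoc]
  right_assoc := by
    rw [← whiskerLeft_comp_assoc, IsMonHom.mul_hom]
    simp only [comp_whiskerRight, MonoidalCategory.tensorHom_def', MonObj.mul_assoc_flip,
      Category.assoc, whiskerLeft_comp]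
    rw [← whisker_exchange_assoc]
    simp
    rw [← whiskerLeft_comp_assoc, whisker_exchange, whiskerLeft_comp_assoc]
  middle_assoc := by
    simp only [comp_whiskerRight, Category.assoc, whiskerLeft_comp]
    rw [← whisker_exchange_assoc, MonObj.mul_assoc, whisker_exchange_assoc]
    simp
    rw [← associator_inv_naturality_left_assoc, Iso.inv_hom_id_assoc, whisker_exchange_assoc,
      associator_naturality_left_assoc]

/-- The multiplication `E ⊗_B E ⟶ E` induced by the multiplication of `E`. -/
noncomputable def restrictMul : restrictBimod f ⊗ restrictBimod f ⟶ restrictBimod f :=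
  bimodDesc (M := restrictBimod f) (N := restrictBimod f) (P := restrictBimod f)
    (MonObj.mul (X := E.X))
    (by
      change (E.X ◁ f.hom ≫ MonObj.mul) ▷ E.X ≫ MonObj.mul =
        (α_ E.X B.X E.X).hom ≫ E.X ◁ (f.hom ▷ E.X ≫ MonObj.mul) ≫ MonObj.mul
      rw [comp_whiskerRight, Category.assoc, MonObj.mul_assoc]
      simp)
    (by
      change (f.hom ▷ E.X ≫ MonObj.mul) ▷ E.X ≫ MonObj.mul =
        (α_ B.X E.X E.X).hom ≫ B.X ◁ MonObj.mul ≫ f.hom ▷ E.X ≫ MonObj.mul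
      rw [comp_whiskerRight, Category.assoc, MonObj.mul_assoc, whisker_exchange_assoc]
      simp)
    (by
      change E.X ◁ (E.X ◁ f.hom ≫ MonObj.mul) ≫ MonObj.mul =
        (α_ E.X E.X B.X).inv ≫ MonObj.mul ▷ B.X ≫ E.X ◁ f.hom ≫ MonObj.mul
      rw [whiskerLeft_comp, Category.assoc, MonObj.mul_assoc_flip, ← whisker_exchange_assoc]
      simp)

/-- An algebra homomorphism `B ⟶ E`, as a morphism of `B`-bimodules. -/
def restrictOne : 𝟙_ (Bimod B B) ⟶ restrictBimod f where
  hom := f.hom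
  left_act_hom := by
    change MonObj.mul ≫ f.hom = B.X ◁ f.hom ≫ f.hom ▷ E.X ≫ MonObj.mul
    rw [IsMonHom.mul_hom, MonoidalCategory.tensorHom_def', Category.assoc]
  right_act_hom := by
    change MonObj.mul ≫ f.hom = f.hom ▷ B.X ≫ E.X ◁ f.hom ≫ MonObj.mul
    rw [IsMonHom.mul_hom, MonoidalCategory.tensorHom_def, Category.assoc]

end Bimodules

/-! ### The relative tensor algebra -/

section TensorAlgebra

variable {C : Type u} [Category.{v} C] [MonoidalCategory C] [HasColimitsOfSize.{0, 0} C]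
  [∀ X : C, PreservesColimitsOfSize.{0, 0} (tensorLeft X)]
  [∀ X : C, PreservesColimitsOfSize.{0, 0} (tensorRight X)]
  {B : Mon C} (M : Bimod B B)

/-- The tensor algebra `T_B(M)` as a graded algebra: its component of degree `n` is the `n`-fold
tensor power of `M` over `B`, and its local multiplications are
`M^{⊗_B a} ⊗ M^{⊗_B b} ⟶ M^{⊗_B a} ⊗_B M^{⊗_B b} ≅ M^{⊗_B (a+b)}`. -/
noncomputable def tensorGraded : GradedAlg C := (tpowGraded M).map (Bimod.forget B)

/-- The tensor algebra `T_B(M) = ⊕ₙ M^{⊗_B n}`. -/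
noncomputable def tensorAlg : Mon C := (tensorGraded M).total

/-- The inclusion `B ⟶ T_B(M)` in degree `0`. -/
noncomputable def tensorAlgι₀ : B.X ⟶ (tensorAlg M).X := Sigma.ι (tensorGraded M).X 0

/-- The inclusion `M ⟶ T_B(M)` in degree `1`. The degree `1` component of `T_B(M)` is `B ⊗_B M`,
which is identified with `M` by the unit constraint. -/
noncomputable def tensorAlgι₁ : M.X ⟶ (tensorAlg M).X :=
  (λ_ M).inv.hom ≫ Sigma.ι (tensorGraded M).X 1

end TensorAlgebra

/-! ### The degree zero part of a graded algebra -/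

section DegreeZero

variable {C : Type u} [Category.{v} C] [MonoidalCategory C] (G : GradedAlg C)

/-- The degree zero part of a graded algebra is an algebra. -/
def GradedAlg.degZero : Mon C where
  X := G.X 0
  mon :=
    { one := G.one
      mul := G.mul (Nat.zero_add 0)
      one_mul := G.one_mul 0
      mul_one := G.mul_one 0
      mul_assoc := G.assoc _ _ _ _ }

/-- Every component of a graded algebra is a bimodule over the degree zero part. -/
def GradedAlg.degBimod (n : ℕ) : Bimod G.degZero G.degZero where
  X := G.X n
  actLeft := G.mul (Nat.zero_add n)
  actRight := G.mul (Nat.add_zero n)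
  one_actLeft := G.one_mul n
  actRight_one := G.mul_one n
  left_assoc := G.assoc _ _ _ _
  right_assoc := by
    rw [Iso.eq_inv_comp]
    exact (G.assoc _ _ _ _).symm
  middle_assoc := G.assoc _ _ _ _

variable [HasColimitsOfSize.{0, 0} C]
  [∀ X : C, PreservesColimitsOfSize.{0, 0} (tensorLeft X)]
  [∀ X : C, PreservesColimitsOfSize.{0, 0} (tensorRight X)]

/-- The inclusion of the degree zero part, as an algebra homomorphism. -/
noncomputable def GradedAlg.inclZero : G.degZero ⟶ G.total where
  hom := Sigma.ι G.X 0
  isMonHom_hom :=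
    { one_hom := rfl
      mul_hom := (G.ι_mul_ι (Nat.zero_add 0)).symm }

/-- The inclusion of a component, as a morphism of bimodules over the degree zero part. -/
noncomputable def GradedAlg.inclBimod (n : ℕ) : G.degBimod n ⟶ restrictBimod G.inclZero where
  hom := Sigma.ι G.X n
  left_act_hom := by
    refine (G.ι_mul_ι (Nat.zero_add n)).symm.trans ?_
    rw [MonoidalCategory.tensorHom_def']
    exact Category.assoc _ _ _
  right_act_hom := by
    refine (G.ι_mul_ι (Nat.add_zero n)).symm.trans ?_
    rw [MonoidalCategory.tensorHom_def]
    exact Category.assoc _ _ _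

end DegreeZero

/-! ### Products and powers of subobjects, ideals -/

section Ideals

variable {C : Type u} [Category.{v} C] [Abelian C] [MonoidalCategory C]

/-- The product `J K` of two subobjects of an algebra `A`: the image of `J ⊗ K ⟶ A ⊗ A ⟶ A`. -/
noncomputable def mulOver {A : Mon C} (J K : MonoOver A.X) : MonoOver A.X :=
  MonoOver.mk (image.ι ((J.arrow ⊗ₘ K.arrow) ≫ MonObj.mul (X := A.X)))

/-- The powers of a subobject of an algebra `A`: `J⁰ = A`, `J¹ = J`, `Jⁿ⁺¹ = Jⁿ J` for `n ≥ 1`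
(for an ideal `J` one has `A J = J`, so that the last equation holds for `n = 0` as well). -/
noncomputable def powOver {A : Mon C} (J : MonoOver A.X) : ℕ → MonoOver A.X
  | 0 => MonoOver.mk (𝟙 A.X)
  | 1 => J
  | n + 2 => mulOver (powOver J (n + 1)) J

/-- An ideal of an algebra `A`: an `A`-bimodule with a morphism of bimodules to `A` which is a
monomorphism in the ambient category. -/
structure AlgIdeal (A : Mon C) where
  bimod : Bimod A A
  incl : bimod ⟶ Bimod.regular A
  mono_incl : Mono incl.hom

namespace AlgIdeal

variable {A : Mon C} (I : AlgIdeal A)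

/-- The inclusion `I ⟶ A` in the ambient category. -/
def arrow : I.bimod.X ⟶ A.X := I.incl.hom

instance : Mono I.arrow := I.mono_incl

/-- The power `Iⁿ` of an ideal, as a subobject of `A`. -/
noncomputable def pow (n : ℕ) : MonoOver A.X :=
  powOver (MonoOver.mk I.arrow) n

/-- The multiplication of `A` restricts to `J ⊗ K ⟶ L`. -/
def Fac (J K L : MonoOver A.X) : Prop :=
  ∃ f : (J : C) ⊗ (K : C) ⟶ (L : C), f ≫ L.arrow = (J.arrow ⊗ₘ K.arrow) ≫ MonObj.mul

theorem exists_lift_of_epi {X Y Z W : C} (e : X ⟶ Y) [Epi e] (m : Z ⟶ W) [Mono m] (f : Y ⟶ W)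
    (g : X ⟶ Z) (h : g ≫ m = e ≫ f) : ∃ l : Y ⟶ Z, l ≫ m = f := by
  have := strongEpi_of_epi e
  have sq : CommSq g e m f := ⟨h⟩
  exact ⟨sq.lift, sq.fac_right⟩

theorem fac_mulOver_epi (J K : MonoOver A.X) : ∃ f : (J : C) ⊗ (K : C) ⟶ (mulOver J K : C), Epi f ∧
    f ≫ (mulOver J K).arrow = (J.arrow ⊗ₘ K.arrow) ≫ MonObj.mul :=
  ⟨factorThruImage ((J.arrow ⊗ₘ K.arrow) ≫ MonObj.mul (X := A.X)),
    inferInstanceAs (Epi (factorThruImage ((J.arrow ⊗ₘ K.arrow) ≫ MonObj.mul (X := A.X)))),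
    image.fac _⟩

theorem fac_mulOver (J K : MonoOver A.X) : Fac J K (mulOver J K) :=
  ⟨_, (fac_mulOver_epi J K).choose_spec.2⟩

variable [∀ X : C, PreservesColimitsOfSize.{0, 0} (tensorLeft X)]
  [∀ X : C, PreservesColimitsOfSize.{0, 0} (tensorRight X)]

instance epi_whiskerLeft (W : C) {X Y : C} (f : X ⟶ Y) [Epi f] : Epi (W ◁ f) :=
  inferInstanceAs (Epi ((tensorLeft W).map f))

instance epi_whiskerRight (W : C) {X Y : C} (f : X ⟶ Y) [Epi f] : Epi (f ▷ W) :=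
  inferInstanceAs (Epi ((tensorRight W).map f))

instance epi_tensorHom {X Y X' Y' : C} (f : X ⟶ Y) (g : X' ⟶ Y') [Epi f] [Epi g] :
    Epi (f ⊗ₘ g) := by
  rw [MonoidalCategory.tensorHom_def]
  infer_instance

theorem fac_mulOver_right {J K L Q N : MonoOver A.X} (h₁ : Fac J K Q) (h₂ : Fac Q L N) :
    Fac J (mulOver K L) N := by
  obtain ⟨f, hf⟩ := h₁
  obtain ⟨g, hg⟩ := h₂
  obtain ⟨p, _, hp⟩ := fac_mulOver_epi K L
  refine exists_lift_of_epi ((J : C) ◁ p) N.arrow _ ((α_ _ _ _).inv ≫ f ▷ (L : C) ≫ g) ?_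
  rw [Category.assoc, Category.assoc, hg, ← tensorHom_id, tensorHom_comp_tensorHom_assoc, hf,
    Category.id_comp, ← id_tensorHom, tensorHom_comp_tensorHom_assoc, hp, Category.id_comp,
    ← Category.comp_id L.arrow, ← tensorHom_comp_tensorHom_assoc, tensorHom_id, MonObj.mul_assoc,
    Category.comp_id, ← associator_inv_naturality_assoc, Iso.inv_hom_id_assoc,
    ← id_tensorHom, tensorHom_comp_tensorHom_assoc, Category.comp_id]

theorem fac_mulOver_left {J K L Q N : MonoOver A.X} (h₁ : Fac K L Q) (h₂ : Fac J Q N) :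
    Fac (mulOver J K) L N := by
  obtain ⟨f, hf⟩ := h₁
  obtain ⟨g, hg⟩ := h₂
  obtain ⟨p, _, hp⟩ := fac_mulOver_epi J K
  refine exists_lift_of_epi (p ▷ (L : C)) N.arrow _ ((α_ _ _ _).hom ≫ (J : C) ◁ f ≫ g) ?_
  rw [Category.assoc, Category.assoc, hg, ← id_tensorHom, tensorHom_comp_tensorHom_assoc, hf,
    Category.id_comp, ← tensorHom_id, tensorHom_comp_tensorHom_assoc, hp, Category.id_comp,
    ← Category.comp_id J.arrow, ← tensorHom_comp_tensorHom_assoc, id_tensorHom,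
    Category.comp_id, ← associator_naturality_assoc, ← MonObj.mul_assoc,
    ← tensorHom_id, tensorHom_comp_tensorHom_assoc, Category.comp_id]

theorem fac_pow_zero (n : ℕ) : Fac (I.pow n) (I.pow 0) (I.pow n) := by
  have h₁ : Fac (I.pow 1) (I.pow 0) (I.pow 1) :=
    ⟨I.bimod.actRight, (I.incl.right_act_hom).trans
      (congrArg (· ≫ _) (tensorHom_id (f := I.arrow) (Y := A.X))).symm⟩
  match n with
  | 0 => exact ⟨MonObj.mul (X := A.X), (Category.comp_id _).trans
      ((congrArg (· ≫ _) (id_tensorHom_id A.X A.X)).trans (Category.id_comp _)).symm⟩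
  | 1 => exact h₁
  | _ + 2 => exact fac_mulOver_left h₁ (fac_mulOver _ _)

theorem fac_pow : ∀ a b : ℕ, Fac (I.pow a) (I.pow b) (I.pow (a + b))
  | a, 0 => I.fac_pow_zero a
  | 0, 1 => ⟨I.bimod.actLeft, I.incl.left_act_hom.trans
      (congrArg (· ≫ _) (id_tensorHom (f := I.arrow) (X := A.X))).symm⟩
  | _ + 1, 1 => fac_mulOver _ _
  | a, b + 2 => fac_mulOver_right (fac_pow a (b + 1)) (fac_mulOver (I.pow (a + b + 1)) _)

theorem exists_powMul {a b c : ℕ} (h : a + b = c) :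
    ∃ f : (I.pow a : C) ⊗ (I.pow b : C) ⟶ (I.pow c : C),
      f ≫ (I.pow c).arrow = ((I.pow a).arrow ⊗ₘ (I.pow b).arrow) ≫ MonObj.mul := by
  subst h; exact I.fac_pow a b

/-- The multiplication `Iᵃ ⊗ Iᵇ ⟶ Iᶜ` for `a + b = c`, the restriction of the one of `A`. -/
noncomputable def powMul {a b c : ℕ} (h : a + b = c) :
    (I.pow a : C) ⊗ (I.pow b : C) ⟶ (I.pow c : C) := (I.exists_powMul h).choose

theorem powMul_arrow {a b c : ℕ} (h : a + b = c) :
    I.powMul h ≫ (I.pow c).arrow = ((I.pow a).arrow ⊗ₘ (I.pow b).arrow) ≫ MonObj.mul :=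
  (I.exists_powMul h).choose_spec

theorem exists_powIncl (n : ℕ) :
    ∃ f : (I.pow (n + 2) : C) ⟶ (I.pow (n + 1) : C),
      f ≫ (I.pow (n + 1)).arrow = (I.pow (n + 2)).arrow := by
  obtain ⟨p, _, hp⟩ := fac_mulOver_epi (I.pow (n + 1)) (MonoOver.mk I.arrow)
  obtain ⟨g, hg⟩ := I.fac_pow_zero (n + 1)
  let j : (MonoOver.mk I.arrow : C) ⟶ (I.pow 0 : C) := I.arrow
  have hj : j ≫ (I.pow 0).arrow = (MonoOver.mk I.arrow).arrow := Category.comp_id _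
  refine exists_lift_of_epi p (I.pow (n + 1)).arrow _ ((I.pow (n + 1) : C) ◁ j ≫ g) ?_
  refine Eq.trans ?_ hp.symm
  rw [Category.assoc, hg, ← id_tensorHom, tensorHom_comp_tensorHom_assoc, hj, Category.id_comp]

/-- The inclusion `Iⁿ⁺¹ ⟶ Iⁿ`; for `n = 0` it is the inclusion `I ⟶ A`. -/
noncomputable def powIncl : ∀ n : ℕ, (I.pow (n + 1) : C) ⟶ (I.pow n : C)
  | 0 => I.arrow
  | n + 1 => (I.exists_powIncl n).choose

theorem powIncl_arrow : ∀ n : ℕ, I.powIncl n ≫ (I.pow n).arrow = (I.pow (n + 1)).arrow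
  | 0 => Category.comp_id _
  | n + 1 => (I.exists_powIncl n).choose_spec

theorem powIncl_mul {a b c : ℕ} (h : a + b = c) :
    I.powIncl a ▷ (I.pow b : C) ≫ I.powMul h =
      I.powMul (show a + 1 + b = c + 1 by omega) ≫ I.powIncl c := by
  rw [← cancel_mono (I.pow c).arrow, Category.assoc, Category.assoc, I.powMul_arrow,
    I.powIncl_arrow, I.powMul_arrow, ← tensorHom_id, tensorHom_comp_tensorHom_assoc,
    I.powIncl_arrow, Category.id_comp]

theorem mul_powIncl {a b c : ℕ} (h : a + b = c) :
    (I.pow a : C) ◁ I.powIncl b ≫ I.powMul h =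
      I.powMul (show a + (b + 1) = c + 1 by omega) ≫ I.powIncl c := by
  rw [← cancel_mono (I.pow c).arrow, Category.assoc, Category.assoc, I.powMul_arrow,
    I.powIncl_arrow, I.powMul_arrow, ← id_tensorHom, tensorHom_comp_tensorHom_assoc,
    I.powIncl_arrow, Category.id_comp]

/-- The unit of `A`, as a morphism to `I⁰ = A`. -/
def powOne : 𝟙_ C ⟶ (I.pow 0 : C) := MonObj.one (X := A.X)

theorem powOne_arrow : I.powOne ≫ (I.pow 0).arrow = MonObj.one (X := A.X) :=
  Category.comp_id _

theorem powMul_one_mul (a : ℕ) :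
    I.powOne ▷ (I.pow a : C) ≫ I.powMul (Nat.zero_add a) = (λ_ (I.pow a : C)).hom := by
  rw [← cancel_mono (I.pow a).arrow, Category.assoc, I.powMul_arrow, ← tensorHom_id,
    tensorHom_comp_tensorHom_assoc, I.powOne_arrow, Category.id_comp,
    MonoidalCategory.tensorHom_def', Category.assoc, MonObj.one_mul, leftUnitor_naturality]

theorem powMul_mul_one (a : ℕ) :
    (I.pow a : C) ◁ I.powOne ≫ I.powMul (Nat.add_zero a) = (ρ_ (I.pow a : C)).hom := by
  rw [← cancel_mono (I.pow a).arrow, Category.assoc, I.powMul_arrow, ← id_tensorHom,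
    tensorHom_comp_tensorHom_assoc, I.powOne_arrow, Category.id_comp,
    MonoidalCategory.tensorHom_def, Category.assoc, MonObj.mul_one, rightUnitor_naturality]

theorem powMul_assoc {a b c ab bc abc : ℕ} (h₁ : a + b = ab) (h₂ : ab + c = abc)
    (h₃ : b + c = bc) (h₄ : a + bc = abc) :
    I.powMul h₁ ▷ (I.pow c : C) ≫ I.powMul h₂ =
      (α_ (I.pow a : C) (I.pow b : C) (I.pow c : C)).hom ≫ (I.pow a : C) ◁ I.powMul h₃ ≫
        I.powMul h₄ := by
  rw [← cancel_mono (I.pow abc).arrow]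
  simp only [Category.assoc]
  rw [I.powMul_arrow, I.powMul_arrow, ← tensorHom_id, ← id_tensorHom,
    tensorHom_comp_tensorHom_assoc, tensorHom_comp_tensorHom_assoc, I.powMul_arrow,
    I.powMul_arrow, Category.id_comp, Category.id_comp,
    ← Category.comp_id (I.pow c).arrow, ← tensorHom_comp_tensorHom_assoc, tensorHom_id,
    MonObj.mul_assoc, associator_naturality_assoc, Category.comp_id,
    ← id_tensorHom, tensorHom_comp_tensorHom_assoc, Category.comp_id]

/-! ### The associated graded algebra -/

/-- The component `grⁿ_I A = Iⁿ / Iⁿ⁺¹`. -/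
noncomputable def grX (n : ℕ) : C := cokernel (I.powIncl n)

/-- The projection `Iⁿ ⟶ Iⁿ / Iⁿ⁺¹`. -/
noncomputable def grπ (n : ℕ) : (I.pow n : C) ⟶ I.grX n := cokernel.π (I.powIncl n)

instance (n : ℕ) : Epi (I.grπ n) := inferInstanceAs (Epi (cokernel.π (I.powIncl n)))

theorem powIncl_π (n : ℕ) : I.powIncl n ≫ I.grπ n = 0 := cokernel.condition _

variable [MonoidalPreadditive C]

theorem exists_tensor_desc {X₁ X₂ Y₁ Y₂ Z : C} (f₁ : X₁ ⟶ Y₁) (f₂ : X₂ ⟶ Y₂) (g : Y₁ ⊗ Y₂ ⟶ Z)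
    (h₁ : f₁ ▷ Y₂ ≫ g = 0) (h₂ : Y₁ ◁ f₂ ≫ g = 0) :
    ∃ h : cokernel f₁ ⊗ cokernel f₂ ⟶ Z, (cokernel.π f₁ ⊗ₘ cokernel.π f₂) ≫ h = g := by
  have e₁ : cokernel.π f₁ ▷ Y₂ ≫ (PreservesCokernel.iso (tensorRight Y₂) f₁).hom =
      cokernel.π (f₁ ▷ Y₂) := PreservesCokernel.π_iso_hom (tensorRight Y₂) f₁
  obtain ⟨k, hk⟩ : ∃ k : cokernel f₁ ⊗ Y₂ ⟶ Z, cokernel.π f₁ ▷ Y₂ ≫ k = g :=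
    ⟨(PreservesCokernel.iso (tensorRight Y₂) f₁).hom ≫ cokernel.desc _ g h₁, by
      rw [reassoc_of% e₁]; exact cokernel.π_desc _ _ _⟩
  have hk0 : cokernel f₁ ◁ f₂ ≫ k = 0 := by
    rw [← cancel_epi (cokernel.π f₁ ▷ X₂), ← whisker_exchange_assoc, hk, h₂, comp_zero]
  have e₂ : cokernel f₁ ◁ cokernel.π f₂ ≫ (PreservesCokernel.iso (tensorLeft (cokernel f₁)) f₂).hom =
      cokernel.π (cokernel f₁ ◁ f₂) := PreservesCokernel.π_iso_hom (tensorLeft _) f₂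
  refine ⟨(PreservesCokernel.iso (tensorLeft (cokernel f₁)) f₂).hom ≫ cokernel.desc _ k hk0, ?_⟩
  rw [MonoidalCategory.tensorHom_def, Category.assoc, reassoc_of% e₂]
  exact (congrArg (_ ≫ ·) (cokernel.π_desc _ _ _)).trans hk

theorem exists_grMul {a b c : ℕ} (h : a + b = c) :
    ∃ f : I.grX a ⊗ I.grX b ⟶ I.grX c, (I.grπ a ⊗ₘ I.grπ b) ≫ f = I.powMul h ≫ I.grπ c := by
  refine exists_tensor_desc _ _ _ ?_ ?_
  · rw [← Category.assoc, I.powIncl_mul, Category.assoc, I.powIncl_π, comp_zero]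
  · rw [← Category.assoc, I.mul_powIncl, Category.assoc, I.powIncl_π, comp_zero]

/-- The multiplication `Iᵃ/Iᵃ⁺¹ ⊗ Iᵇ/Iᵇ⁺¹ ⟶ Iᶜ/Iᶜ⁺¹` for `a + b = c`, induced by
`Iᵃ ⊗ Iᵇ ⟶ Iᶜ`. -/
noncomputable def grMul {a b c : ℕ} (h : a + b = c) : I.grX a ⊗ I.grX b ⟶ I.grX c :=
  (I.exists_grMul h).choose

theorem π_grMul {a b c : ℕ} (h : a + b = c) :
    (I.grπ a ⊗ₘ I.grπ b) ≫ I.grMul h = I.powMul h ≫ I.grπ c :=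
  (I.exists_grMul h).choose_spec

/-- The associated graded algebra `gr_I A`, with its components `Iⁿ / Iⁿ⁺¹`. -/
noncomputable def gr : GradedAlg C where
  X := I.grX
  mul h := I.grMul h
  one := I.powOne ≫ I.grπ 0
  one_mul a := by
    rw [← cancel_epi (𝟙_ C ◁ I.grπ a), whisker_exchange_assoc, comp_whiskerRight, Category.assoc,
      ← MonoidalCategory.tensorHom_def_assoc, I.π_grMul, ← Category.assoc, I.powMul_one_mul,
      leftUnitor_naturality]
  mul_one a := by
    rw [← cancel_epi (I.grπ a ▷ 𝟙_ C), ← whisker_exchange_assoc, whiskerLeft_comp, Category.assoc,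
      ← MonoidalCategory.tensorHom_def'_assoc, I.π_grMul, ← Category.assoc, I.powMul_mul_one,
      rightUnitor_naturality]
  assoc {a b c ab bc abc} h₁ h₂ h₃ h₄ := by
    rw [← cancel_epi ((I.grπ a ⊗ₘ I.grπ b) ⊗ₘ I.grπ c), ← tensorHom_id,
      tensorHom_comp_tensorHom_assoc, I.π_grMul, Category.comp_id,
      ← Category.id_comp (I.grπ c), ← tensorHom_comp_tensorHom_assoc, I.π_grMul, tensorHom_id,
      ← Category.assoc, I.powMul_assoc h₁ h₂ h₃ h₄, Category.id_comp, associator_naturality_assoc,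
      ← id_tensorHom (I.grX a), tensorHom_comp_tensorHom_assoc, I.π_grMul, Category.comp_id,
      ← Category.id_comp (I.grπ a), ← tensorHom_comp_tensorHom_assoc, I.π_grMul, id_tensorHom]
    simp only [Category.assoc]

/-- The quotient algebra `A / I`: the degree zero part of `gr_I A`, which is the cokernel of
`I ⟶ A` with the multiplication and the unit induced by those of `A` (see `quotProj`). -/
noncomputable abbrev quotAlg : Mon C := I.gr.degZero

/-- The `A / I`-bimodule `I / I²`: the degree one part of `gr_I A`, with the actions induced by
the multiplication of `A`. -/
noncomputable abbrev conormal : Bimod I.quotAlg I.quotAlg := I.gr.degBimod 1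

/-- The projection `A ⟶ A / I` is an algebra homomorphism. -/
noncomputable def quotProj : A ⟶ I.quotAlg where
  hom := cokernel.π I.arrow
  isMonHom_hom :=
    { one_hom := rfl
      mul_hom := by
        let m : (I.pow 0 : C) ⊗ (I.pow 0 : C) ⟶ (I.pow 0 : C) := MonObj.mul (X := A.X)
        have hm : m ≫ (I.pow 0).arrow = ((I.pow 0).arrow ⊗ₘ (I.pow 0).arrow) ≫ MonObj.mul :=
          (Category.comp_id _).trans
            ((congrArg (· ≫ _) (id_tensorHom_id A.X A.X)).trans (Category.id_comp _)).symm
        have h : I.powMul (Nat.zero_add 0) = m := by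
          rw [← cancel_mono (I.pow 0).arrow, I.powMul_arrow, hm]
        have e := I.π_grMul (Nat.zero_add 0)
        rw [h] at e
        exact e.symm }

end AlgIdeal

end Ideals

/-! ### Strong grading, and the subobjects of elements of degree at least `n` -/

section Grading

variable {C : Type u} [Category.{v} C] [MonoidalCategory C]

/-- A graded algebra is strongly `ℕ`-graded if all its multiplications `X i ⊗ X j ⟶ X (i + j)`
are epimorphisms. -/
def GradedAlg.IsStronglyGraded (G : GradedAlg C) : Prop :=
  ∀ i j : ℕ, Epi (G.mul (rfl : i + j = i + j))

variable [Abelian C] [HasColimitsOfSize.{0, 0} C]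

/-- The canonical morphism `⊕_{i ≥ n} Xᵢ ⟶ ⊕ᵢ Xᵢ`. -/
noncomputable def tailMap (X : ℕ → C) (n : ℕ) : (∐ fun i : {i : ℕ // n ≤ i} => X i) ⟶ ∐ X :=
  Sigma.desc fun i => Sigma.ι X i

instance mono_tailMap (X : ℕ → C) (n : ℕ) : Mono (tailMap X n) := by
  let r : (∐ X) ⟶ ∐ fun i : {i : ℕ // n ≤ i} => X i :=
    Sigma.desc fun i => if h : n ≤ i then
      Sigma.ι (fun i : {i : ℕ // n ≤ i} => X i) ⟨i, h⟩ else 0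
  have h : tailMap X n ≫ r = 𝟙 _ := by
    refine Sigma.hom_ext _ _ fun i => ?_
    rw [tailMap, Sigma.ι_desc_assoc, Sigma.ι_desc, dif_pos i.2, Category.comp_id]
  have : Mono (tailMap X n ≫ r) := by rw [h]; infer_instance
  exact mono_of_mono _ r

variable [∀ X : C, PreservesColimitsOfSize.{0, 0} (tensorLeft X)]
  [∀ X : C, PreservesColimitsOfSize.{0, 0} (tensorRight X)]

/-- The subobject `⊕_{i ≥ n} Xᵢ` of the algebra `⊕ᵢ Xᵢ`. -/
noncomputable def GradedAlg.tail (G : GradedAlg C) (n : ℕ) : MonoOver G.total.X :=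
  @MonoOver.mk C _ G.total.X _ (tailMap G.X n) (mono_tailMap G.X n)

end Grading

/-! ### Compatibility of the tensor product with direct sums -/

/-- The tensor product of a monoidal category commutes with direct sums, in each variable. -/
class TensorCommutesWithDirectSums (C : Type u) [Category.{v} C] [MonoidalCategory C] : Prop where
  left : ∀ (X : C) (J : Type v), PreservesColimitsOfShape (Discrete J) (tensorLeft X)
  right : ∀ (X : C) (J : Type v), PreservesColimitsOfShape (Discrete J) (tensorRight X)

section DirectSums

variable {C : Type u} [Category.{v} C] [HasColimits C]

theorem preservesSmall (F : C ⥤ C) [PreservesFiniteColimits F]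
    (h : ∀ J : Type v, PreservesColimitsOfShape (Discrete J) F) :
    PreservesColimitsOfSize.{0, 0} F := by
  have hs : PreservesColimitsOfSize.{v, v} F :=
    preservesColimits_of_preservesCoequalizers_and_coproducts F
  exact preservesSmallestColimits_of_preservesColimits F

variable [MonoidalCategory C] [TensorCommutesWithDirectSums C]

instance preservesSmall_tensorLeft (X : C) [PreservesFiniteColimits (tensorLeft X)] :
    PreservesColimitsOfSize.{0, 0} (tensorLeft X) :=
  preservesSmall _ (TensorCommutesWithDirectSums.left X)

instance preservesSmall_tensorRight (X : C) [PreservesFiniteColimits (tensorRight X)] :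
    PreservesColimitsOfSize.{0, 0} (tensorRight X) :=
  preservesSmall _ (TensorCommutesWithDirectSums.right X)

end DirectSums

/-! ### The morphism from the tensor algebra to the associated graded algebra -/

section Comparison

variable {C : Type u} [Category.{v} C] [Abelian C] [HasColimitsOfSize.{0, 0} C]
  [MonoidalCategory C]
  [∀ X : C, PreservesColimitsOfSize.{0, 0} (tensorLeft X)]
  [∀ X : C, PreservesColimitsOfSize.{0, 0} (tensorRight X)]

/-- For a graded algebra `G = ⊕ₙ Gₙ` and `B = G₀`, the morphism
`p_t ∘ m̄^{t-1} ∘ (i₁)^{⊗_B t} : G₁^{⊗_B t} ⟶ G_t`, where `i₁ : G₁ ⟶ G` is the inclusion,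
`m̄^{t-1} : G^{⊗_B t} ⟶ G` is the iteration of the multiplication `m̄ : G ⊗_B G ⟶ G`
(for `t = 0` it is the inclusion `B ⟶ G`), and `p_t : G ⟶ G_t` is the projection. -/
noncomputable def GradedAlg.powerMap (G : GradedAlg C) (t : ℕ) :
    (tensorGraded (G.degBimod 1)).X t ⟶ G.X t :=
  (tpowMap (G.inclBimod 1) t).hom ≫
    (iterMul (restrictMul G.inclZero) (restrictOne G.inclZero) t).hom ≫ Sigma.π G.X t

end Comparison

/-- The assertions of a list are equivalent, and they all hold. -/
def EquivalentAndHold (l : List Prop) : Prop := l.TFAE ∧ ∀ P ∈ l, P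

end AssocGraded

/-!
Each product of powers `Iᵃ ⊗ Iᵇ ⟶ Iᵃ⁺ᵇ` is an epimorphism: for `a ≥ 1` the power `Iᵃ⁺¹` is by
definition the image of `Iᵃ ⊗ I`, and associativity gives the rest by induction on `b`
(`AlgIdeal.epi_powMul`). Hence `gr_I A` is strongly graded, and in particular all its products
`gr^a ⊗ gr^1 ⟶ gr^{a+1}` are epimorphisms. The other assertions follow from the latter for every
graded algebra `G`, as explained below; since all assertions hold, they are equivalent. The
comparison morphism likewise exists for every graded algebra `G`, with `B = G₀`.

For such a `G`, the iterated multiplication restricted to `G₁^{⊗_B t}` takes its values in degree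
`t` (`GradedAlg.powerMap_ι`), and the resulting components `c_t = GradedAlg.powerMap` satisfy the
recursion `c_{t+1} ∘ π = m ∘ (c_t ⊗ 1)`, where `π : G₁^{⊗_B t} ⊗ G₁ ⟶ G₁^{⊗_B (t+1)}` is the
canonical epimorphism (`GradedAlg.powerStep_powerMap`). From the recursion follow, by induction,
the compatibility of the `c_t` with products (`GradedAlg.powerMap_mul`), so that `⊕ c_t` is an
algebra homomorphism, and the fact that every `c_t` is an epimorphism as soon as all products
`G_a ⊗ G₁ ⟶ G_{a+1}` are (`GradedAlg.epi_powerMap`). Uniqueness holds because `π` is right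
multiplication by the generators in the tensor algebra (`tensorGraded_mul_one`), which is
therefore generated in degrees `0` and `1` (`tensorAlg_hom_ext`).

Finally, when all `G_a ⊗ G₁ ⟶ G_{a+1}` are epimorphisms, so is the multiplication
`⊕_{i ≥ n} Gᵢ ⊗ ⊕_{i ≥ 1} Gᵢ ⟶ ⊕_{i ≥ n+1} Gᵢ`, which identifies its target with a product of
subobjects, and the powers of `⊕_{i ≥ 1} Gᵢ` are computed by induction
(`GradedAlg.mk_tail_eq_mk_powOver`).
-/

namespace AssocGraded

/-! ### Tensor products of coproducts, and homomorphisms of total algebras -/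

section Coproducts

variable {C : Type u} [Category.{v} C] [MonoidalCategory C] [HasColimitsOfSize.{0, 0} C]
  [∀ X : C, PreservesColimitsOfSize.{0, 0} (tensorLeft X)]
  [∀ X : C, PreservesColimitsOfSize.{0, 0} (tensorRight X)]

/-- Morphisms out of `(⊕ⱼ Xⱼ) ⊗ (⊕ₖ Yₖ)` are determined by their components, for coproducts over
arbitrary index types. -/
theorem sigma_tensor_sigma_hom_ext {J K : Type} {X : J → C} {Y : K → C} {Z : C}
    {f g : (∐ X) ⊗ (∐ Y) ⟶ Z}
    (h : ∀ j k, (Sigma.ι X j ⊗ₘ Sigma.ι Y k) ≫ f = (Sigma.ι X j ⊗ₘ Sigma.ι Y k) ≫ g) :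
    f = g := by
  rw [← cancel_epi (PreservesCoproduct.iso (tensorRight (∐ Y)) X).inv]
  refine Sigma.hom_ext _ _ fun j => ?_
  have e₁ : Sigma.ι (fun j => (tensorRight (∐ Y)).obj (X j)) j ≫
      (PreservesCoproduct.iso (tensorRight (∐ Y)) X).inv = Sigma.ι X j ▷ (∐ Y) :=
    ι_comp_sigmaComparison (tensorRight (∐ Y)) X j
  rw [reassoc_of% e₁, reassoc_of% e₁,
    ← cancel_epi (PreservesCoproduct.iso (tensorLeft (X j)) Y).inv]
  refine Sigma.hom_ext _ _ fun k => ?_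
  have e₂ : Sigma.ι (fun k => (tensorLeft (X j)).obj (Y k)) k ≫
      (PreservesCoproduct.iso (tensorLeft (X j)) Y).inv = X j ◁ Sigma.ι Y k :=
    ι_comp_sigmaComparison (tensorLeft (X j)) Y k
  rw [reassoc_of% e₂, reassoc_of% e₂, ← MonoidalCategory.tensorHom_def'_assoc,
    ← MonoidalCategory.tensorHom_def'_assoc]
  exact h j k

/-- A family of morphisms compatible with units and local multiplications induces an algebra
homomorphism between the total algebras. -/
noncomputable def GradedAlg.totalHom (G H : GradedAlg C) (c : ∀ n, G.X n ⟶ H.X n)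
    (hone : G.one ≫ c 0 = H.one)
    (hmul : ∀ a b : ℕ, G.mul (rfl : a + b = a + b) ≫ c (a + b) = (c a ⊗ₘ c b) ≫ H.mul rfl) :
    G.total ⟶ H.total where
  hom := Limits.Sigma.map c
  isMonHom_hom :=
    { one_hom := by
        have h : (G.one ≫ Sigma.ι G.X 0) ≫ Limits.Sigma.map c = H.one ≫ Sigma.ι H.X 0 := by
          rw [Category.assoc, Sigma.ι_map, reassoc_of% hone]
        exact h
      mul_hom := by
        have h : G.totalMul ≫ Limits.Sigma.map c =
            (Limits.Sigma.map c ⊗ₘ Limits.Sigma.map c) ≫ H.totalMul := by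
          refine sigma_tensor_sigma_hom_ext fun a b => ?_
          rw [← Category.assoc, G.ι_mul_ι rfl, Category.assoc, Sigma.ι_map,
            tensorHom_comp_tensorHom_assoc, Sigma.ι_map, Sigma.ι_map,
            ← tensorHom_comp_tensorHom_assoc, H.ι_mul_ι rfl, reassoc_of% (hmul a b)]
        exact h }

end Coproducts

/-! ### Generation of the relative tensor algebra in degrees zero and one -/

section TensorAlgebra

variable {C : Type u} [Category.{v} C] [MonoidalCategory C] [HasColimitsOfSize.{0, 0} C]
  [∀ X : C, PreservesColimitsOfSize.{0, 0} (tensorLeft X)]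
  [∀ X : C, PreservesColimitsOfSize.{0, 0} (tensorRight X)]
  {B : Mon C} (M : Bimod B B)

/-- The canonical epimorphism `M^{⊗_B n} ⊗ M ⟶ M^{⊗_B n} ⊗_B M = M^{⊗_B (n+1)}`. -/
noncomputable def tensorGradedStep (n : ℕ) :
    (tensorGraded M).X n ⊗ M.X ⟶ (tensorGraded M).X (n + 1) :=
  bimodπ (tpow M n) M

instance (n : ℕ) : Epi (tensorGradedStep M n) :=
  inferInstanceAs (Epi (bimodπ (tpow M n) M))

/-- The identification of `M` with the component `B ⊗_B M` of degree `1` of `T_B(M)`. -/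
noncomputable def toTensorGradedOne : M.X ⟶ (tensorGraded M).X 1 :=
  (λ_ M).inv.hom

/-- Under `M ≅ 𝟙 ⊗ M = M^{⊗ 1}`, concatenation `M^{⊗ n} ⊗ M^{⊗ 1} ⟶ M^{⊗ (n+1)}` is the identity of
`M^{⊗ n} ⊗ M`: this is the triangle identity. -/
theorem tpow_whiskerLeft_tpowMul_one (n : ℕ) :
    tpow M n ◁ (λ_ M).inv ≫ tpowMul M (rfl : n + 1 = n + 1) = 𝟙 (tpow M n ⊗ M) := by
  have e := tpowMul_succ M (Nat.add_zero n)
  rw [tpowMul_zero] at e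
  have t : tpow M n ◁ (λ_ M).inv ≫ (α_ (tpow M n) (𝟙_ (Bimod B B)) M).inv ≫
      (ρ_ (tpow M n)).hom ▷ M = 𝟙 (tpow M n ⊗ M) := by
    simp
  exact (congrArg (tpow M n ◁ (λ_ M).inv ≫ ·) e).trans t

/-- In the tensor algebra, right multiplication by the generators `M` is the canonical
epimorphism `M^{⊗_B n} ⊗ M ⟶ M^{⊗_B (n+1)}`. -/
theorem tensorGraded_mul_one (n : ℕ) :
    (tensorGraded M).X n ◁ toTensorGradedOne M ≫ (tensorGraded M).mul (rfl : n + 1 = n + 1) =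
      tensorGradedStep M n := by
  have h := congrArg Bimod.Hom.hom (tpow_whiskerLeft_tpowMul_one M n)
  have hπ := bimodπ_whiskerLeft (tpow M n) (λ_ M).inv
  refine ((Category.assoc _ _ _).symm.trans (congrArg (· ≫ (tpowMul M rfl).hom) hπ.symm)).trans ?_
  exact (Category.assoc _ _ _).trans ((congrArg (bimodπ (tpow M n) M ≫ ·) h).trans
    (Category.comp_id _))

/-- Associativity of the multiplication of the tensor algebra with respect to the generators. -/
theorem tensorGraded_mul_step (a b : ℕ) :
    (tensorGraded M).X a ◁ tensorGradedStep M b ≫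
        (tensorGraded M).mul (rfl : a + (b + 1) = a + b + 1) =
      (α_ _ _ _).inv ≫ (tensorGraded M).mul (rfl : a + b = a + b) ▷ M.X ≫
        tensorGradedStep M (a + b) := by
  have h := (tensorGraded M).assoc (rfl : a + b = a + b) (rfl : a + b + 1 = a + b + 1)
    (rfl : b + 1 = b + 1) (add_assoc a b 1).symm
  rw [← tensorGraded_mul_one, ← tensorGraded_mul_one, ← whisker_exchange_assoc, h, whiskerLeft_comp,
    Category.assoc]
  simp

/-- The tensor algebra is generated by its components of degrees `0` and `1`. -/
theorem tensorAlg_hom_ext {E : Mon C} {f g : tensorAlg M ⟶ E}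
    (h₀ : tensorAlgι₀ M ≫ f.hom = tensorAlgι₀ M ≫ g.hom)
    (h₁ : tensorAlgι₁ M ≫ f.hom = tensorAlgι₁ M ≫ g.hom) : f = g := by
  -- A multiplicative `k` is determined in degree `n + 1` by its values in degree `n` and on `M`.
  have key : ∀ k : ∐ (tensorGraded M).X ⟶ E.X,
      (tensorGraded M).totalMul ≫ k = (k ⊗ₘ k) ≫ MonObj.mul (X := E.X) → ∀ n : ℕ,
      tensorGradedStep M n ≫ Sigma.ι (tensorGraded M).X (n + 1) ≫ k =
        ((Sigma.ι (tensorGraded M).X n ≫ k) ⊗ₘ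
          ((toTensorGradedOne M ≫ Sigma.ι (tensorGraded M).X 1) ≫ k)) ≫
            MonObj.mul (X := E.X) := fun k hk n => by
    rw [← tensorHom_comp_tensorHom_assoc, ← hk, ← tensorGraded_mul_one,
      ← Category.id_comp (Sigma.ι (tensorGraded M).X n), ← tensorHom_comp_tensorHom_assoc,
      reassoc_of% ((tensorGraded M).ι_mul_ι (rfl : n + 1 = n + 1)), id_tensorHom, Category.assoc]
  refine Mon.Hom.ext (Sigma.hom_ext _ _ fun n => ?_)
  induction n with
  | zero => exact h₀
  | succ n ih =>
    refine (cancel_epi (tensorGradedStep M n)).1 ?_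
    exact (key f.hom (IsMonHom.mul_hom f.hom) n).trans
      ((congrArg₂ (fun x y => (x ⊗ₘ y) ≫ MonObj.mul (X := E.X)) ih h₁).trans
        (key g.hom (IsMonHom.mul_hom g.hom) n).symm)

end TensorAlgebra

/-! ### The comparison from the tensor algebra of the degree one part -/

section Comparison

variable {C : Type u} [Category.{v} C] [Abelian C] [HasColimitsOfSize.{0, 0} C]
  [MonoidalCategory C]
  [∀ X : C, PreservesColimitsOfSize.{0, 0} (tensorLeft X)]
  [∀ X : C, PreservesColimitsOfSize.{0, 0} (tensorRight X)]

namespace GradedAlg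

variable (G : GradedAlg C)

/-- The morphism `m̄^{t-1} ∘ (i₁)^{⊗_B t} : G₁^{⊗_B t} ⟶ ⊕ₙ Gₙ` of bimodules over `B = G₀`. -/
noncomputable def powerHom (t : ℕ) :
    tpow (G.degBimod 1) t ⟶ restrictBimod G.inclZero :=
  tpowMap (G.inclBimod 1) t ≫ iterMul (restrictMul G.inclZero) (restrictOne G.inclZero) t

/-- The morphism underlying `powerHom`. -/
noncomputable def powerTotal (t : ℕ) : (tensorGraded (G.degBimod 1)).X t ⟶ ∐ G.X :=
  (G.powerHom t).hom

theorem powerMap_eq (t : ℕ) : G.powerMap t = G.powerTotal t ≫ Sigma.π G.X t :=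
  (Category.assoc _ _ _).symm

theorem powerTotal_zero : G.powerTotal 0 = Sigma.ι G.X 0 :=
  Category.id_comp (Sigma.ι G.X 0)

theorem powerMap_zero : G.powerMap 0 = 𝟙 (G.X 0) :=
  (G.powerMap_eq 0).trans ((congrArg (· ≫ Sigma.π G.X 0) G.powerTotal_zero).trans
    (Sigma.ι_π_eq_id G.X 0))

/-- The canonical epimorphism `G₁^{⊗_B t} ⊗ G₁ ⟶ G₁^{⊗_B (t+1)}`, for `B = G₀`. -/
noncomputable def powerStep (t : ℕ) :
    (tensorGraded (G.degBimod 1)).X t ⊗ G.X 1 ⟶ (tensorGraded (G.degBimod 1)).X (t + 1) :=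
  tensorGradedStep (G.degBimod 1) t

instance (t : ℕ) : Epi (G.powerStep t) :=
  inferInstanceAs (Epi (tensorGradedStep (G.degBimod 1) t))

theorem mul_powerStep (a b : ℕ) :
    (tensorGraded (G.degBimod 1)).X a ◁ G.powerStep b ≫
        (tensorGraded (G.degBimod 1)).mul (rfl : a + (b + 1) = a + b + 1) =
      (α_ _ _ _).inv ≫ (tensorGraded (G.degBimod 1)).mul (rfl : a + b = a + b) ▷ G.X 1 ≫
        G.powerStep (a + b) :=
  tensorGraded_mul_step (G.degBimod 1) a b

theorem powerStep_powerTotal (t : ℕ) :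
    G.powerStep t ≫ G.powerTotal (t + 1) = (G.powerTotal t ⊗ₘ Sigma.ι G.X 1) ≫ G.totalMul := by
  have h : G.powerHom (t + 1) = G.powerHom t ▷ G.degBimod 1 ≫
      restrictBimod G.inclZero ◁ G.inclBimod 1 ≫ restrictMul G.inclZero := by
    change (tpowMap _ t ⊗ₘ _) ≫ iterMul _ _ t ▷ _ ≫ _ = _
    rw [MonoidalCategory.tensorHom_def, powerHom, comp_whiskerRight, Category.assoc,
      Category.assoc, whisker_exchange_assoc]
  have e₁ := bimodπ_whiskerRight (G.powerHom t) (G.degBimod 1)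
  have e₂ := bimodπ_whiskerLeft (restrictBimod G.inclZero) (G.inclBimod 1)
  have e₃ : bimodπ (restrictBimod G.inclZero) (restrictBimod G.inclZero) ≫
      (restrictMul G.inclZero).hom = MonObj.mul (X := G.total.X) :=
    coequalizer.π_desc _ _
  have h' : bimodπ (tpow (G.degBimod 1) t) (G.degBimod 1) ≫ (G.powerHom (t + 1)).hom =
      (G.powerHom t).hom ▷ (G.degBimod 1).X ≫
        (restrictBimod G.inclZero).X ◁ (G.inclBimod 1).hom ≫ MonObj.mul (X := G.total.X) := by
    rw [h, Bimod.comp_hom', Bimod.comp_hom', reassoc_of% e₁, reassoc_of% e₂, e₃]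
    rfl
  rw [MonoidalCategory.tensorHom_def, Category.assoc]
  exact h'

/-- `m̄^{t-1} ∘ (i₁)^{⊗_B t}` takes its values in degree `t`. -/
theorem powerMap_ι (t : ℕ) : G.powerMap t ≫ Sigma.ι G.X t = G.powerTotal t := by
  induction t with
  | zero =>
    exact (congrArg (· ≫ Sigma.ι G.X 0) G.powerMap_zero).trans
      ((Category.id_comp _).trans G.powerTotal_zero.symm)
  | succ t ih =>
    have h : G.powerStep t ≫ G.powerTotal (t + 1) =
        G.powerMap t ▷ G.X 1 ≫ G.mul rfl ≫ Sigma.ι G.X (t + 1) := by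
      rw [powerStep_powerTotal, ← ih, ← Category.id_comp (Sigma.ι G.X 1),
        ← tensorHom_comp_tensorHom_assoc, G.ι_mul_ι rfl, tensorHom_id]
    rw [← cancel_epi (G.powerStep t), powerMap_eq, Category.assoc, reassoc_of% h, h,
      Sigma.ι_π_eq_id_assoc]

/-- The recursion satisfied by the morphisms `G₁^{⊗_B t} ⟶ G_t`. -/
theorem powerStep_powerMap (t : ℕ) :
    G.powerStep t ≫ G.powerMap (t + 1) =
      G.powerMap t ▷ G.X 1 ≫ G.mul (rfl : t + 1 = t + 1) := by
  rw [powerMap_eq, ← Category.assoc, powerStep_powerTotal, ← powerMap_ι,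
    ← Category.id_comp (Sigma.ι G.X 1), ← tensorHom_comp_tensorHom_assoc, G.ι_mul_ι rfl,
    tensorHom_id, Category.assoc, Category.assoc, Sigma.ι_π_eq_id, Category.comp_id]

/-- `powerMap` in degree one is the left unitor `B ⊗_B G₁ ≅ G₁`, so that it becomes the identity on
`G₁`. -/
theorem toTensorGradedOne_powerMap :
    toTensorGradedOne (G.degBimod 1) ≫ G.powerMap 1 = 𝟙 (G.X 1) := by
  have e : G.powerMap 0 ▷ G.X 1 ≫ G.mul (rfl : 0 + 1 = 1) = (G.degBimod 1).actLeft :=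
    (congrArg (fun f : G.X 0 ⟶ G.X 0 => f ▷ G.X 1 ≫ G.mul (rfl : 0 + 1 = 1))
      G.powerMap_zero).trans ((congrArg (· ≫ _) (id_whiskerRight _ _)).trans (Category.id_comp _))
  have h : G.powerMap 1 = (λ_ (G.degBimod 1)).hom.hom :=
    (cancel_epi (G.powerStep 0)).1 ((G.powerStep_powerMap 0).trans
      (e.trans (bimodπ_leftUnitor (G.degBimod 1)).symm))
  exact (congrArg (toTensorGradedOne (G.degBimod 1) ≫ ·) h).trans
    (congrArg Bimod.Hom.hom (λ_ (G.degBimod 1)).inv_hom_id)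

/-- The morphisms `G₁^{⊗_B t} ⟶ G_t` are multiplicative. -/
theorem powerMap_mul (a b : ℕ) :
    (tensorGraded (G.degBimod 1)).mul (rfl : a + b = a + b) ≫ G.powerMap (a + b) =
      (G.powerMap a ⊗ₘ G.powerMap b) ≫ G.mul rfl := by
  induction b with
  | zero =>
    -- Multiplication by degree `0` is the right action of `B`, which `powerHom` respects.
    have h : (tensorGraded (G.degBimod 1)).mul (rfl : a + 0 = a + 0) =
        (tpow (G.degBimod 1) a).actRight := by
      refine Eq.trans ?_ (bimodπ_rightUnitor (tpow (G.degBimod 1) a))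
      exact congrArg (fun f => bimodπ _ _ ≫ Bimod.Hom.hom f) (tpowMul_zero (G.degBimod 1) a)
    have h' : (tensorGraded (G.degBimod 1)).mul (rfl : a + 0 = a + 0) ≫ G.powerTotal a =
        G.powerTotal a ▷ G.X 0 ≫ (∐ G.X) ◁ Sigma.ι G.X 0 ≫ G.totalMul :=
      (congrArg (· ≫ G.powerTotal a) h).trans (G.powerHom a).right_act_hom
    have h₂ : G.powerTotal a ▷ G.X 0 ≫ (∐ G.X) ◁ Sigma.ι G.X 0 ≫ G.totalMul =
        (G.powerMap a ▷ G.X 0 ≫ G.mul (rfl : a + 0 = a)) ≫ Sigma.ι G.X a := by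
      rw [Category.assoc, ← G.ι_mul_ι (Nat.add_zero a), ← G.powerMap_ι, comp_whiskerRight, Category.assoc,
        MonoidalCategory.tensorHom_def, Category.assoc]
    have h₃ : (G.powerMap a ⊗ₘ G.powerMap 0) ≫ G.mul (rfl : a + 0 = a + 0) =
        G.powerMap a ▷ G.X 0 ≫ G.mul (rfl : a + 0 = a) :=
      (congrArg (fun f : G.X 0 ⟶ G.X 0 => (G.powerMap a ⊗ₘ f) ≫ G.mul (rfl : a + 0 = a))
        G.powerMap_zero).trans (congrArg (· ≫ _) (tensorHom_id _ _))
    have : Mono (Sigma.ι G.X a) := mono_of_mono_fac (Sigma.ι_π_eq_id G.X a)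
    refine Eq.trans ((cancel_mono (Sigma.ι G.X a)).1 ?_) h₃.symm
    exact (Category.assoc _ _ _).trans ((congrArg (_ ≫ ·) (G.powerMap_ι a)).trans (h'.trans h₂))
  | succ b ih =>
    -- After the canonical epimorphism `X a ⊗ (X b ⊗ G₁) ⟶ X a ⊗ X (b + 1)`, both sides are the
    -- product of `powerMap a`, `powerMap b` and the identity of `G₁`.
    rw [← cancel_epi ((tensorGraded (G.degBimod 1)).X a ◁ G.powerStep b)]
    have h := G.mul_powerStep a b
    have h₁ : (tensorGraded (G.degBimod 1)).X a ◁ G.powerStep b ≫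
        (tensorGraded (G.degBimod 1)).mul (rfl : a + (b + 1) = a + b + 1) ≫
          G.powerMap (a + b + 1) =
        (α_ _ _ _).inv ≫ ((G.powerMap a ⊗ₘ G.powerMap b) ⊗ₘ 𝟙 (G.X 1)) ≫
          G.mul (rfl : a + b = a + b) ▷ G.X 1 ≫ G.mul (rfl : a + b + 1 = a + b + 1) := by
      rw [reassoc_of% h, powerStep_powerMap, ← comp_whiskerRight_assoc, ih, tensorHom_id,
        comp_whiskerRight_assoc]
    have h₂ : (tensorGraded (G.degBimod 1)).X a ◁ G.powerStep b ≫
        (G.powerMap a ⊗ₘ G.powerMap (b + 1)) ≫ G.mul (rfl : a + (b + 1) = a + b + 1) =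
        (α_ _ _ _).inv ≫ ((G.powerMap a ⊗ₘ G.powerMap b) ⊗ₘ 𝟙 (G.X 1)) ≫
          G.mul (rfl : a + b = a + b) ▷ G.X 1 ≫ G.mul (rfl : a + b + 1 = a + b + 1) := by
      rw [G.assoc rfl rfl (rfl : b + 1 = b + 1) (rfl : a + (b + 1) = a + b + 1),
        associator_naturality_assoc, Iso.inv_hom_id_assoc, ← id_tensorHom,
        tensorHom_comp_tensorHom_assoc, powerStep_powerMap, ← id_tensorHom,
        tensorHom_comp_tensorHom_assoc, tensorHom_id, Category.id_comp, Category.comp_id]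
    exact h₁.trans h₂.symm

/-- For a graded algebra `G`, the morphisms `G₁^{⊗_B t} ⟶ G_t` form an algebra homomorphism
from the tensor algebra of `G₁` over `B = G₀` to the total algebra of `G`. -/
noncomputable def fromTensorAlg : tensorAlg (G.degBimod 1) ⟶ G.total :=
  totalHom (tensorGraded (G.degBimod 1)) G G.powerMap
    ((congrArg (_ ≫ ·) G.powerMap_zero).trans ((Category.comp_id _).trans (Category.comp_id _)))
    G.powerMap_mul

theorem ι_fromTensorAlg (n : ℕ) :
    Sigma.ι (tensorGraded (G.degBimod 1)).X n ≫ G.fromTensorAlg.hom =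
      G.powerMap n ≫ Sigma.ι G.X n :=
  Sigma.ι_map _ _

theorem ι₀_fromTensorAlg :
    tensorAlgι₀ (G.degBimod 1) ≫ G.fromTensorAlg.hom = Sigma.ι G.X 0 :=
  (G.ι_fromTensorAlg 0).trans ((G.powerMap_ι 0).trans G.powerTotal_zero)

theorem ι₁_fromTensorAlg :
    tensorAlgι₁ (G.degBimod 1) ≫ G.fromTensorAlg.hom = Sigma.ι G.X 1 := by
  have h : (toTensorGradedOne (G.degBimod 1) ≫ Sigma.ι (tensorGraded (G.degBimod 1)).X 1) ≫
      Limits.Sigma.map G.powerMap = Sigma.ι G.X 1 := by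
    rw [Category.assoc, Sigma.ι_map, reassoc_of% G.toTensorGradedOne_powerMap]
    exact Category.id_comp (Sigma.ι G.X 1)
  exact h

end GradedAlg

end Comparison

/-! ### The associated graded algebra is strongly graded -/

section StronglyGraded

variable {C : Type u} [Category.{v} C] [Abelian C] [MonoidalCategory C]
  [∀ X : C, PreservesColimitsOfSize.{0, 0} (tensorLeft X)]
  [∀ X : C, PreservesColimitsOfSize.{0, 0} (tensorRight X)]

namespace AlgIdeal

variable {A : Mon C} (I : AlgIdeal A)

/-- For `a = 0` the multiplication is the left action of `A` on `I`, split by the unit of `A`; for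
`a ≥ 1` it is the epimorphism onto the image that defines `Iᵃ⁺¹`. -/
theorem epi_powMul_one (a : ℕ) : Epi (I.powMul (rfl : a + 1 = a + 1)) := by
  match a with
  | 0 =>
    have h : I.powOne ▷ (I.pow 1 : C) ≫ I.powMul (rfl : 0 + 1 = 1) =
      (λ_ (I.pow 1 : C)).hom := I.powMul_one_mul 1
    exact epi_of_epi_fac h
  | a + 1 =>
    obtain ⟨p, hp, hp'⟩ := fac_mulOver_epi (I.pow (a + 1)) (MonoOver.mk I.arrow)
    have h : I.powMul (rfl : a + 1 + 1 = a + 1 + 1) = p :=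
      (cancel_mono (I.pow (a + 2)).arrow).1 ((I.powMul_arrow rfl).trans hp'.symm)
    rw [h]
    exact hp

theorem epi_powMul (a b : ℕ) : Epi (I.powMul (rfl : a + b = a + b)) := by
  induction b with
  | zero => exact epi_of_epi_fac (I.powMul_mul_one a)
  | succ b ih =>
    have h := I.powMul_assoc (rfl : a + b = a + b) (rfl : a + b + 1 = a + b + 1)
      (rfl : b + 1 = b + 1) (rfl : a + (b + 1) = a + b + 1)
    have := I.epi_powMul_one (a + b)
    rw [← Iso.inv_comp_eq] at h
    exact epi_of_epi_fac h.symm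

/-- The associated graded algebra is strongly graded, as `Iᵃ ⊗ Iᵇ ⟶ Iᵃ⁺ᵇ` is an epimorphism. -/
theorem gr_isStronglyGraded [MonoidalPreadditive C] : I.gr.IsStronglyGraded := fun a b => by
  have : Epi (I.powMul (rfl : a + b = a + b) ≫ I.grπ (a + b)) :=
    @epi_comp _ _ _ _ _ _ (I.epi_powMul a b) _ inferInstance
  have h : Epi (I.grMul (rfl : a + b = a + b)) := epi_of_epi_fac (I.π_grMul rfl)
  exact h

end AlgIdeal

end StronglyGraded

/-! ### Graded algebras generated in degree one -/

section Generation

variable {C : Type u} [Category.{v} C] [Abelian C] [HasColimitsOfSize.{0, 0} C]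
  [MonoidalCategory C]
  [∀ X : C, PreservesColimitsOfSize.{0, 0} (tensorLeft X)]
  [∀ X : C, PreservesColimitsOfSize.{0, 0} (tensorRight X)]

theorem epi_sigmaMap {X Y : ℕ → C} (c : ∀ n, X n ⟶ Y n) [∀ n, Epi (c n)] :
    Epi (Limits.Sigma.map c) where
  left_cancellation f g h := Sigma.hom_ext _ _ fun n => by
    rw [← cancel_epi (c n), ← Category.assoc, ← Category.assoc, ← Sigma.ι_map, Category.assoc,
      Category.assoc, h]

/-- A subobject through which `J ⊗ K ⟶ A` factors by an epimorphism is the product `J K`. -/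
theorem mk_eq_mk_mulOver_of_epi {A : Mon C} {J K L : MonoOver A.X}
    (p : (J : C) ⊗ (K : C) ⟶ (L : C)) [Epi p]
    (h : p ≫ L.arrow = (J.arrow ⊗ₘ K.arrow) ≫ MonObj.mul (X := A.X)) :
    Subobject.mk L.arrow = Subobject.mk (mulOver J K).arrow := by
  obtain ⟨q, _, hq⟩ := AlgIdeal.fac_mulOver_epi J K
  obtain ⟨l, hl⟩ := AlgIdeal.exists_lift_of_epi p (mulOver J K).arrow L.arrow q (hq.trans h.symm)
  obtain ⟨r, hr⟩ := AlgIdeal.exists_lift_of_epi q L.arrow (mulOver J K).arrow p (h.trans hq.symm)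
  exact le_antisymm (Subobject.mk_le_mk_of_comm l hl) (Subobject.mk_le_mk_of_comm r hr)

namespace GradedAlg

variable (G : GradedAlg C)

theorem epi_powerMap (h : ∀ a : ℕ, Epi (G.mul (rfl : a + 1 = a + 1))) (n : ℕ) :
    Epi (G.powerMap n) := by
  induction n with
  | zero =>
    exact (congrArg (fun f : G.X 0 ⟶ G.X 0 => Epi f) G.powerMap_zero).mpr inferInstance
  | succ n ih =>
    have := h n
    exact epi_of_epi_fac (G.powerStep_powerMap n)

/-- The multiplication of `⊕ᵢ Gᵢ` maps `⊕_{i ≥ m} Gᵢ ⊗ ⊕_{j ≥ n} Gⱼ` to `⊕_{k ≥ m + n} Gₖ`. -/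
theorem exists_tailMul (m n : ℕ) :
    ∃ p : ((G.tail m : MonoOver G.total.X) : C) ⊗ (G.tail n : C) ⟶ (G.tail (m + n) : C),
      p ≫ (G.tail (m + n)).arrow =
        ((G.tail m).arrow ⊗ₘ (G.tail n).arrow) ≫ MonObj.mul (X := G.total.X) := by
  -- The projection `r` onto the target produces the morphism: the product of elements of degrees at
  -- least `m` and `n` lies where `r` followed by the inclusion is the identity.
  let r : (∐ G.X) ⟶ ∐ fun i : {i : ℕ // m + n ≤ i} => G.X i :=
    Sigma.desc fun i => if h : m + n ≤ i then
      Sigma.ι (fun i : {i : ℕ // m + n ≤ i} => G.X i) ⟨i, h⟩ else 0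
  have hr : ∀ i, m + n ≤ i → Sigma.ι G.X i ≫ r ≫ tailMap G.X (m + n) = Sigma.ι G.X i :=
    fun i hi => by
      rw [Sigma.ι_desc_assoc, dif_pos hi, tailMap, Sigma.ι_desc]
  have h : ((tailMap G.X m ⊗ₘ tailMap G.X n) ≫ G.totalMul ≫ r) ≫ tailMap G.X (m + n) =
      (tailMap G.X m ⊗ₘ tailMap G.X n) ≫ G.totalMul := by
    refine sigma_tensor_sigma_hom_ext fun i j => ?_
    simp only [Category.assoc, tensorHom_comp_tensorHom_assoc]
    rw [tailMap, tailMap, Sigma.ι_desc, Sigma.ι_desc, reassoc_of% (G.ι_mul_ι rfl),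
      hr _ (add_le_add i.2 j.2), G.ι_mul_ι rfl]
  exact ⟨_, h⟩

/-- If `G` is generated in degree one over `G₀`, then `⊕_{i ≥ n+1} Gᵢ` is the product of
`⊕_{i ≥ n} Gᵢ` and `⊕_{i ≥ 1} Gᵢ`: already `Gᵢ ⊗ G₁` maps onto `Gᵢ₊₁` for `i ≥ n`. -/
theorem mk_tail_add_one (h : ∀ a : ℕ, Epi (G.mul (rfl : a + 1 = a + 1))) (n : ℕ) :
    Subobject.mk (G.tail (n + 1)).arrow =
      Subobject.mk (mulOver (G.tail n) (G.tail 1)).arrow := by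
  obtain ⟨p, hp⟩ := G.exists_tailMul n 1
  have hι : ∀ (i : ℕ) (hi : n ≤ i),
      (Sigma.ι (fun i : {i : ℕ // n ≤ i} => G.X i) ⟨i, hi⟩ ⊗ₘ
        Sigma.ι (fun i : {i : ℕ // 1 ≤ i} => G.X i) ⟨1, le_rfl⟩) ≫ p =
      G.mul (rfl : i + 1 = i + 1) ≫
        Sigma.ι (fun i : {i : ℕ // n + 1 ≤ i} => G.X i) ⟨i + 1, Nat.succ_le_succ hi⟩ :=
    fun i hi => by
      have hp' : p ≫ tailMap G.X (n + 1) = (tailMap G.X n ⊗ₘ tailMap G.X 1) ≫ G.totalMul := hp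
      have e : (Sigma.ι (fun i : {i : ℕ // n ≤ i} => G.X i) ⟨i, hi⟩ ⊗ₘ
          Sigma.ι (fun i : {i : ℕ // 1 ≤ i} => G.X i) ⟨1, le_rfl⟩) ≫
            (tailMap G.X n ⊗ₘ tailMap G.X 1) ≫ G.totalMul =
          (G.mul (rfl : i + 1 = i + 1) ≫ Sigma.ι (fun i : {i : ℕ // n + 1 ≤ i} => G.X i)
            ⟨i + 1, Nat.succ_le_succ hi⟩) ≫ tailMap G.X (n + 1) := by
        rw [tensorHom_comp_tensorHom_assoc, tailMap, tailMap, tailMap, Sigma.ι_desc,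
          Sigma.ι_desc, Category.assoc, Sigma.ι_desc, G.ι_mul_ι rfl]
      refine (cancel_mono (tailMap G.X (n + 1))).1 ?_
      exact (Category.assoc _ _ _).trans ((congrArg (_ ≫ ·) hp').trans e)
  have : Epi p := ⟨fun f g hfg => by
    refine Sigma.hom_ext _ _ fun ⟨i, hi⟩ => ?_
    obtain ⟨i, rfl⟩ : ∃ k, i = k + 1 := ⟨i - 1, by omega⟩
    have hi' : n ≤ i := Nat.le_of_succ_le_succ hi
    have := h i
    refine (cancel_epi (G.mul (rfl : i + 1 = i + 1))).1 ?_
    refine (Category.assoc _ _ _).symm.trans (Eq.trans ?_ (Category.assoc _ _ _))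
    exact (congrArg (· ≫ f) (hι i hi')).symm.trans ((Category.assoc _ _ _).trans
      ((congrArg (_ ≫ ·) hfg).trans ((Category.assoc _ _ _).symm.trans
        (congrArg (· ≫ g) (hι i hi')))))⟩
  exact mk_eq_mk_mulOver_of_epi p hp

end GradedAlg

theorem mk_mulOver_congr {A : Mon C} {J J' : MonoOver A.X} (K : MonoOver A.X)
    (h : Subobject.mk J.arrow = Subobject.mk J'.arrow) :
    Subobject.mk (mulOver J K).arrow = Subobject.mk (mulOver J' K).arrow := by
  let e : (J' : C) ≅ (J : C) := Subobject.isoOfMkEqMk _ _ h.symm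
  have he : e.hom ≫ J.arrow = J'.arrow := by simp [e]
  obtain ⟨p, _, hp⟩ := AlgIdeal.fac_mulOver_epi J K
  refine mk_eq_mk_mulOver_of_epi (e.hom ▷ (K : C) ≫ p) ?_
  rw [Category.assoc, hp, ← tensorHom_id, tensorHom_comp_tensorHom_assoc, he, Category.id_comp]

/-- If `G` is generated in degree one over `G₀`, then `⊕_{i ≥ n} Gᵢ = (⊕_{i ≥ 1} Gᵢ)ⁿ`. -/
theorem GradedAlg.mk_tail_eq_mk_powOver (G : GradedAlg C)
    (h : ∀ a : ℕ, Epi (G.mul (rfl : a + 1 = a + 1))) :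
    ∀ n : ℕ, Subobject.mk (G.tail n).arrow = Subobject.mk (powOver (G.tail 1) n).arrow
  | 0 => by
    have hs : Sigma.desc (fun i => Sigma.ι (fun i : {i : ℕ // 0 ≤ i} => G.X i) ⟨i, i.zero_le⟩) ≫
        tailMap G.X 0 = 𝟙 (∐ G.X) := by
      refine Sigma.hom_ext _ _ fun i => ?_
      rw [Sigma.ι_desc_assoc, tailMap, Sigma.ι_desc, Category.comp_id]
    exact le_antisymm (Subobject.mk_le_mk_of_comm (tailMap G.X 0) (Category.comp_id _))
      (Subobject.mk_le_mk_of_comm _ hs)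
  | 1 => rfl
  | n + 2 => (G.mk_tail_add_one h (n + 1)).trans
      (mk_mulOver_congr _ (G.mk_tail_eq_mk_powOver h (n + 1)))

end Generation

end AssocGraded

theorem mainTheorem10 {C : Type u} [Category.{v} C] [Abelian C] [HasColimits C]
    [MonoidalCategory C] [MonoidalPreadditive C]
    [∀ X : C, PreservesFiniteColimits (tensorLeft X)]
    [∀ X : C, PreservesFiniteColimits (tensorRight X)]
    [AssocGraded.TensorCommutesWithDirectSums C]
    (A : Mon C) (I : AssocGraded.AlgIdeal A) :
    ∃ φ : AssocGraded.tensorAlg I.conormal ⟶ I.gr.total,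
      (AssocGraded.tensorAlgι₀ I.conormal ≫ φ.hom = Sigma.ι I.gr.X 0 ∧
        AssocGraded.tensorAlgι₁ I.conormal ≫ φ.hom = Sigma.ι I.gr.X 1) ∧
      (∀ ψ : AssocGraded.tensorAlg I.conormal ⟶ I.gr.total,
        AssocGraded.tensorAlgι₀ I.conormal ≫ ψ.hom = Sigma.ι I.gr.X 0 →
        AssocGraded.tensorAlgι₁ I.conormal ≫ ψ.hom = Sigma.ι I.gr.X 1 → ψ = φ) ∧
      ∃ φc : ∀ n : ℕ, (AssocGraded.tensorGraded I.conormal).X n ⟶ I.gr.X n,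
        (∀ n : ℕ, Sigma.ι (AssocGraded.tensorGraded I.conormal).X n ≫ φ.hom =
          φc n ≫ Sigma.ι I.gr.X n) ∧
        (∀ t : ℕ, φc t = I.gr.powerMap t) ∧
        AssocGraded.EquivalentAndHold
          [ I.gr.IsStronglyGraded,
            ∀ a : ℕ, Epi (I.gr.mul (rfl : a + 1 = a + 1)),
            ∀ n : ℕ, Epi (φc n),
            Epi φ.hom,
            ∀ n : ℕ, Subobject.mk (I.gr.tail n).arrow =
              Subobject.mk (AssocGraded.powOver (I.gr.tail 1) n).arrow,
            Subobject.mk (I.gr.tail 2).arrow =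
              Subobject.mk (AssocGraded.powOver (I.gr.tail 1) 2).arrow ] := by
  have hs := I.gr_isStronglyGraded
  have h₁ : ∀ a : ℕ, Epi (I.gr.mul (rfl : a + 1 = a + 1)) := fun a => hs a 1
  have hc := I.gr.epi_powerMap h₁
  have ht := I.gr.mk_tail_eq_mk_powOver h₁
  refine ⟨I.gr.fromTensorAlg, ⟨I.gr.ι₀_fromTensorAlg, I.gr.ι₁_fromTensorAlg⟩,
    fun ψ h₀ h₁ => AssocGraded.tensorAlg_hom_ext _ (h₀.trans I.gr.ι₀_fromTensorAlg.symm)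
      (h₁.trans I.gr.ι₁_fromTensorAlg.symm),
    I.gr.powerMap, I.gr.ι_fromTensorAlg, fun _ => rfl, ?_⟩
  have hall : ∀ P ∈ [ I.gr.IsStronglyGraded,
            ∀ a : ℕ, Epi (I.gr.mul (rfl : a + 1 = a + 1)),
            ∀ n : ℕ, Epi (I.gr.powerMap n),
            Epi I.gr.fromTensorAlg.hom,
            ∀ n : ℕ, Subobject.mk (I.gr.tail n).arrow =
              Subobject.mk (AssocGraded.powOver (I.gr.tail 1) n).arrow,
            Subobject.mk (I.gr.tail 2).arrow =
              Subobject.mk (AssocGraded.powOver (I.gr.tail 1) 2).arrow ], P := by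
    simp only [List.forall_mem_cons, List.not_mem_nil, false_imp_iff, implies_true, and_true]
    exact ⟨hs, h₁, hc, AssocGraded.epi_sigmaMap I.gr.powerMap, ht, ht 2⟩
  exact ⟨fun P hP Q hQ => iff_of_true (hall P hP) (hall Q hQ), hall⟩
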